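/- For every $\varepsilon>0$ there is a constant $C_\varepsilon>0$, depending only on $\varepsilon$, such that the following holds. Let $K\subset\mathbb{C}$ be any imaginary quadratic number field of class number one, with ring of integers $\mathcal{O}_K$, norm $\mathcal{N}$ and discriminant $D_K<0$, and for $z\in\mathbb{C}$ put $$\widetilde{e}_K(z)=\exp\left(2\pi i\left(\frac{z}{\sqrt{D_K}}-\frac{\overline{z}}{\sqrt{D_K}}\right)\right),\qquad \sqrt{D_K}=i\sqrt{|D_K|}.$$ Then for all real $Q,N\ge 1$ and all complex numbers $(a_n)_{n\in\mathcal{O}_K}$, $$\sum_{\substack{q\in\mathcal{O}_K\setminus\{0\}\\ \mathcal{N}(q)\le Q}}\ \sum_{\substack{a \bmod q^2\\ (a,q)=1}}\left|\sum_{\substack{n\in\mathcal{O}_K\\ \mathcal{N}(n)\le N}}a_n\,\widetilde{e}_K\left(\frac{na}{q^2}\right)\right|^2\le C_\varepsilon\,(QN)^{\varepsilon}\left(Q^3+Q^2\sqrt{N}+N\right)\sum_{\substack{n\in\mathcal{O}_K\\ \mathcal{N}(n)\le N}}|a_n|^2 .$$ -/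

import Mathlib

open NumberField

noncomputable section

namespace SquareSieve

/-- The square root `√D_K = i √|D_K|` of the (negative) discriminant of an imaginary quadratic
field `K`, taken in the upper half plane. -/
def sqrtDiscr (K : Type*) [Field K] [NumberField K] : ℂ :=
  Complex.I * ((Real.sqrt |(discr K : ℝ)| : ℝ) : ℂ)

/-- The additive character `ẽ_K(z) = exp (2πi (z / √D_K - conj z / √D_K))` on `ℂ`. -/
def addChar (K : Type*) [Field K] [NumberField K] (z : ℂ) : ℂ :=
  Complex.exp (2 * Real.pi * Complex.I *
    (z / sqrtDiscr K - (starRingEnd ℂ) z / sqrtDiscr K))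

/-- The set of algebraic integers of `K` of norm at most `X`. -/
def normLe (K : Type*) [Field K] [NumberField K] (X : ℝ) : Set (𝓞 K) :=
  {n | (Algebra.norm ℤ n : ℝ) ≤ X}

/-- The residue classes modulo `q ^ 2` whose members are coprime to `q`. -/
def reducedClasses {K : Type*} [Field K] [NumberField K] (q : 𝓞 K) :
    Set (𝓞 K ⧸ Ideal.span {q ^ 2}) :=
  {r | ∃ b : 𝓞 K, Ideal.Quotient.mk (Ideal.span {q ^ 2}) b = r ∧ IsCoprime b q}

/-- The exponential sum `∑_{N(n) ≤ N} a_n ẽ_K(n z)`, where `K` is embedded in `ℂ` by `σ`. -/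
def expSum {K : Type*} [Field K] [NumberField K] (σ : K →+* ℂ) (a : 𝓞 K → ℂ) (N : ℝ)
    (z : ℂ) : ℂ :=
  ∑ᶠ n ∈ normLe K N, a n * addChar K (σ n * z)

/-- The left hand side of the large sieve inequality with square moduli. Every class modulo
`q ^ 2` is evaluated at a representative; `expSum_eq_of_mk_eq` below shows that its choice is
immaterial. All index sets are finite when `K` is imaginary quadratic, by `finite_normLe` and
`finite_reducedClasses`. -/
def sieveSum {K : Type*} [Field K] [NumberField K] (σ : K →+* ℂ) (a : 𝓞 K → ℂ) (Q N : ℝ) : ℝ :=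
  ∑ᶠ q ∈ normLe K Q \ {0}, ∑ᶠ r ∈ reducedClasses q,
    ‖expSum σ a N (σ (Quotient.out r : 𝓞 K) / σ q ^ 2)‖ ^ 2

theorem finite_reducedClasses {K : Type*} [Field K] [NumberField K] {q : 𝓞 K} (hq : q ≠ 0) :
    (reducedClasses q).Finite := by
  have : Finite (𝓞 K ⧸ Ideal.span {q ^ 2}) :=
    Ideal.finiteQuotientOfFreeOfNeBot _ (by simpa using hq)
  exact Set.toFinite _

theorem exists_equiv {K : Type*} [Field K] [NumberField K] [Algebra.IsQuadraticExtension ℚ K]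
    [IsTotallyComplex K] (σ : K →+* ℂ) :
    ∃ e : Fin 2 ≃ (K →ₐ[ℚ] ℂ), (∀ x, e 0 x = σ x) ∧ ∀ x, e 1 x = (starRingEnd ℂ) (σ x) := by
  let s : K →ₐ[ℚ] ℂ := σ.toRatAlgHom
  let t : K →ₐ[ℚ] ℂ := (ComplexEmbedding.conjugate σ).toRatAlgHom
  have hst : s ≠ t := fun h => IsTotallyComplex.complexEmbedding_not_isReal σ
    (RingHom.ext fun x => (DFunLike.congr_fun h x).symm)
  have hcard : Fintype.card (Fin 2) = Fintype.card (K →ₐ[ℚ] ℂ) := by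
    rw [AlgHom.card, Algebra.IsQuadraticExtension.finrank_eq_two, Fintype.card_fin]
  let f : Fin 2 → (K →ₐ[ℚ] ℂ) := ![s, t]
  have hf : Function.Injective f := by
    intro i j hij
    fin_cases i <;> fin_cases j <;> simp_all [f, eq_comm]
  exact ⟨Equiv.ofBijective f ((Fintype.bijective_iff_injective_and_card f).2 ⟨hf, hcard⟩),
    fun _ => rfl, fun _ => rfl⟩

theorem norm_eq_sq {K : Type*} [Field K] [NumberField K] [Algebra.IsQuadraticExtension ℚ K]
    [IsTotallyComplex K] (σ : K →+* ℂ) (n : 𝓞 K) :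
    (Algebra.norm ℤ n : ℝ) = ‖σ n‖ ^ 2 := by
  obtain ⟨e, h0, h1⟩ := exists_equiv σ
  have h := Algebra.norm_eq_prod_embeddings ℚ ℂ (n : K)
  rw [← Algebra.coe_norm_int, ← e.prod_comp, Fin.prod_univ_two, h0, h1, Complex.mul_conj,
    Complex.normSq_eq_norm_sq] at h
  simp only [eq_ratCast, Rat.cast_intCast] at h
  exact_mod_cast h

/-- `Tr (x / √D_K)` is an integer for every algebraic integer `x`. -/
theorem exists_int_trace {K : Type*} [Field K] [NumberField K]
    [Algebra.IsQuadraticExtension ℚ K] [IsTotallyComplex K] (σ : K →+* ℂ) (x : 𝓞 K) :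
    ∃ k : ℤ, σ x / sqrtDiscr K - (starRingEnd ℂ) (σ x) / sqrtDiscr K = k := by
  classical
  obtain ⟨e, h0, h1⟩ := exists_equiv σ
  have hcard : Fintype.card (Module.Free.ChooseBasisIndex ℤ (𝓞 K)) = Fintype.card (Fin 2) := by
    rw [← Module.finrank_eq_card_chooseBasisIndex, RingOfIntegers.rank,
      Algebra.IsQuadraticExtension.finrank_eq_two, Fintype.card_fin]
  let g := Fintype.equivOfCardEq hcard
  let B := (RingOfIntegers.basis K).reindex g
  have hrep : ∀ y : 𝓞 K, σ y = (B.repr y 0 : ℂ) * σ (B 0) + (B.repr y 1 : ℂ) * σ (B 1) := by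
    intro y
    have := congrArg (fun z : 𝓞 K => σ z) (B.sum_repr y)
    simp only [Fin.sum_univ_two, map_add, zsmul_eq_mul, map_mul, map_intCast] at this
    exact this.symm
  have hd := Algebra.discr_eq_det_embeddingsMatrixReindex_pow_two ℚ ℂ
    (fun i => (B i : K)) e
  have hB : (fun i => (B i : K)) = (integralBasis K) ∘ g.symm := by
    funext i
    simp [B]
  have hd2 : (discr K : ℂ) =
      (σ (B 0) * (starRingEnd ℂ) (σ (B 1)) - (starRingEnd ℂ) (σ (B 0)) * σ (B 1)) ^ 2 := by
    nth_rewrite 1 [hB] at hd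
    rw [Algebra.discr_reindex, ← coe_discr, Matrix.det_fin_two] at hd
    simp only [Algebra.embeddingsMatrixReindex, Algebra.embeddingsMatrix, Matrix.reindex_apply,
      Matrix.submatrix_apply, Matrix.of_apply, Equiv.refl_symm, Equiv.symm_symm, Equiv.coe_refl,
      id, h0, h1, eq_ratCast, Rat.cast_intCast] at hd
    rw [hd]
  set u := σ (B 0) with hu
  set v := σ (B 1) with hv
  set t : ℂ := u * (starRingEnd ℂ) v - (starRingEnd ℂ) u * v with ht
  have htr : t = ((2 * (u.im * v.re - u.re * v.im) : ℝ) : ℂ) * Complex.I := by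
    apply Complex.ext <;> simp [ht] <;> ring
  have hneg : (discr K : ℝ) = -(2 * (u.im * v.re - u.re * v.im)) ^ 2 := by
    rw [htr, mul_pow, Complex.I_sq] at hd2
    have h3 : ((discr K : ℝ) : ℂ) =
        ((-(2 * (u.im * v.re - u.re * v.im)) ^ 2 : ℝ) : ℂ) := by
      push_cast
      push_cast at hd2
      rw [hd2]
      ring
    exact_mod_cast h3
  have hsq : sqrtDiscr K ^ 2 = t ^ 2 := by
    rw [← hd2, sqrtDiscr, mul_pow, Complex.I_sq, ← Complex.ofReal_pow,
      Real.sq_sqrt (abs_nonneg _), abs_of_nonpos (by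
        rw [hneg]; nlinarith [sq_nonneg (2 * (u.im * v.re - u.re * v.im))])]
    push_cast
    ring
  have hD : sqrtDiscr K ≠ 0 := by
    intro h
    rw [h, ← hd2] at hsq
    have : (discr K : ℂ) ≠ 0 := by exact_mod_cast discr_ne_zero K
    exact this (by rw [← hsq]; ring)
  have hx := hrep x
  have h1b := hrep 1
  have hxc := congrArg (starRingEnd ℂ) hx
  have h1c := congrArg (starRingEnd ℂ) h1b
  simp only [map_add, map_mul, map_one, map_intCast] at hx hxc h1b h1c
  set c0 := B.repr 1 0
  set c1 := B.repr 1 1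
  set x0 := B.repr x 0
  set x1 := B.repr x 1
  have key : σ x - (starRingEnd ℂ) (σ x) = ((c1 * x0 - c0 * x1 : ℤ) : ℂ) * t := by
    have e1 : σ x - (starRingEnd ℂ) (σ x) = σ x * 1 - (starRingEnd ℂ) (σ x) * 1 := by ring
    rw [e1]
    nth_rewrite 1 [h1c]
    rw [h1b, hxc, hx, ht]
    push_cast
    ring
  rw [← sub_div, key]
  rcases sq_eq_sq_iff_eq_or_eq_neg.1 hsq with h | h
  · exact ⟨c1 * x0 - c0 * x1, by rw [← h]; field_simp⟩
  · refine ⟨-(c1 * x0 - c0 * x1), ?_⟩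
    have : t = -sqrtDiscr K := by rw [h]; ring
    rw [this]
    push_cast
    field_simp

theorem addChar_add_of_integer {K : Type*} [Field K] [NumberField K]
    [Algebra.IsQuadraticExtension ℚ K] [IsTotallyComplex K] (σ : K →+* ℂ) (z : ℂ) (x : 𝓞 K) :
    addChar K (z + σ x) = addChar K z := by
  obtain ⟨k, hk⟩ := exists_int_trace σ x
  rw [addChar, addChar, Complex.exp_eq_exp_iff_exists_int]
  refine ⟨k, ?_⟩
  rw [← hk, map_add]
  ring

/-- The inner exponential sum depends only on the residue class. -/
theorem expSum_eq_of_mk_eq {K : Type*} [Field K] [NumberField K]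
    [Algebra.IsQuadraticExtension ℚ K] [IsTotallyComplex K] (σ : K →+* ℂ) (a : 𝓞 K → ℂ) (N : ℝ)
    {q : 𝓞 K} (hq : q ≠ 0) {b c : 𝓞 K}
    (h : Ideal.Quotient.mk (Ideal.span {q ^ 2}) b = Ideal.Quotient.mk (Ideal.span {q ^ 2}) c) :
    expSum σ a N (σ b / σ q ^ 2) = expSum σ a N (σ c / σ q ^ 2) := by
  obtain ⟨d, hd⟩ := Ideal.mem_span_singleton.1 (Ideal.Quotient.eq.1 h)
  have hb : b = c + q ^ 2 * d := by rw [← hd]; ring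
  have hq0 : σ q ≠ 0 := by simpa using hq
  refine finsum_congr fun n => finsum_congr fun _ => ?_
  rw [← addChar_add_of_integer σ (σ n * (σ c / σ q ^ 2)) (n * d), hb]
  congr 2
  simp only [map_add, map_mul, map_pow]
  field_simp

theorem finite_normLe (K : Type*) [Field K] [NumberField K] [Algebra.IsQuadraticExtension ℚ K]
    [IsTotallyComplex K] (X : ℝ) : (normLe K X).Finite := by
  have h := (Embeddings.finite_of_norm_le K ℂ (Real.sqrt X)).preimage
    (f := fun n : 𝓞 K => (n : K)) (fun a _ b _ hab => RingOfIntegers.ext hab)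
  refine h.subset fun n hn => ⟨n.isIntegral_coe, fun φ => ?_⟩
  apply Real.le_sqrt_of_sq_le
  rw [← norm_eq_sq]
  exact hn

end SquareSieve

end

open NumberField

namespace SquareSieve

/-! Write s = √|D_K|. A duality argument bounds the left side by a constant times (N/s)·P·∑|a_n|²,
where P bounds the number of fractions a/q² in any disc of radius R = s/(16√N) (`sieveSum_le`). It
remains to show that (N/s)·P is at most C·N^ε(Q³ + Q²√N + N), uniformly in the field
(`exists_card_fractions_near_le`).

Approximate the centre x of the disc by a reduced fraction b/r with |r| ≤ 2T and |rx − b| ≤ 3s/T,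
where T = N^{1/4} (`exists_approx`), and put z = x − b/r. A fraction a/q² in the disc yields the
integer m = ar − bq². It satisfies bq² + m ≡ 0 mod r, it is bounded by y·Q with y = (|z| + R)|r|,
and zq² is close to m/r. If m = 0, coprimality makes q² an associate of r, so boundedly many
fractions occur (`card_fractions_eq_le`). If m ≠ 0, then for each m the q lie in two small discs,
one the negative of the other (`near_or_near_neg`), and in few residue classes. Sorting the roots q
of the congruence by the ideal (q − q₀, r), for a fixed root q₀, gives one class modulo g per
divisor of r, where r = hg and h² ∣ 4m (`exists_modulus`). The class modulo g instead of r costs a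
factor at most |h|² in counting q, and the divisibility by h² saves the same factor in counting m.
What is left is the divisor function of r, which is O(N^ε) with a constant independent of K
(`exists_card_divisors_le`), and an elementary inequality (`scaled_count_bound_le`).

Uniformity in K comes from s ≥ 1 and from keeping s explicit in every lattice point count. Class
number one supplies the reduced fractions and the factorisation behind `exists_modulus`. -/

theorem map_coe_ne_zero {K : Type*} [Field K] (σ : K →+* ℂ) {x : 𝓞 K} (hx : x ≠ 0) :
    σ x ≠ 0 := by
  simpa using hx

/-! ### The ring of integers as a planar lattice, and lattice points in discs -/

section Lattice

variable {K : Type*} [Field K] [NumberField K]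

variable (K) in
/-- The square root of the absolute value of the discriminant. -/
noncomputable def rootDisc : ℝ := Real.sqrt |(discr K : ℝ)|

theorem one_le_rootDisc : 1 ≤ rootDisc K := by
  rw [rootDisc, Real.one_le_sqrt]
  exact_mod_cast Int.one_le_abs (discr_ne_zero K)

theorem rootDisc_pos : 0 < rootDisc K := zero_lt_one.trans_le one_le_rootDisc

theorem rootDisc_sq : rootDisc K ^ 2 = |(discr K : ℝ)| := Real.sq_sqrt (abs_nonneg _)

theorem sub_conj_div_sqrtDiscr (z : ℂ) :
    z / sqrtDiscr K - (starRingEnd ℂ) z / sqrtDiscr K = ((2 * z.im / rootDisc K : ℝ) : ℂ) := by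
  have h : ((rootDisc K : ℝ) : ℂ) ≠ 0 := by exact_mod_cast rootDisc_pos.ne'
  have h1 : sqrtDiscr K = Complex.I * (rootDisc K : ℂ) := rfl
  rw [← sub_div, Complex.sub_conj, h1]
  push_cast
  field_simp

theorem addChar_eq (z : ℂ) :
    addChar K z = Complex.exp (((4 * Real.pi * z.im / rootDisc K : ℝ) : ℂ) * Complex.I) := by
  rw [addChar, sub_conj_div_sqrtDiscr]
  congr 1
  push_cast
  ring

theorem addChar_add (z w : ℂ) : addChar K (z + w) = addChar K z * addChar K w := by
  rw [addChar_eq, addChar_eq, addChar_eq, ← Complex.exp_add, Complex.add_im]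
  congr 1
  push_cast
  ring

theorem addChar_zero : addChar K 0 = 1 := by simp [addChar]

theorem conj_addChar (z : ℂ) : (starRingEnd ℂ) (addChar K z) = addChar K (-z) := by
  rw [addChar_eq, addChar_eq, ← Complex.exp_conj]
  congr 1
  simp only [map_mul, Complex.conj_ofReal, Complex.conj_I, Complex.neg_im]
  push_cast
  ring

variable [Algebra.IsQuadraticExtension ℚ K] [IsTotallyComplex K] (σ : K →+* ℂ)

theorem exists_im_eq (x : 𝓞 K) : ∃ k : ℤ, (σ x).im = k * (rootDisc K / 2) := by
  obtain ⟨k, hk⟩ := exists_int_trace σ x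
  rw [sub_conj_div_sqrtDiscr] at hk
  have h2 : 2 * (σ x).im / rootDisc K = k := by exact_mod_cast hk
  refine ⟨k, ?_⟩
  rw [← h2]
  field_simp [rootDisc_pos.ne']

theorem one_le_norm {x : 𝓞 K} (hx : x ≠ 0) : 1 ≤ ‖σ x‖ := by
  have h := norm_eq_sq σ x
  have h0 : (Algebra.norm ℤ x : ℝ) ≠ 0 := by
    exact_mod_cast Algebra.norm_ne_zero_iff.2 hx
  have h1 : (0 : ℝ) < Algebra.norm ℤ x := lt_of_le_of_ne (by rw [h]; positivity) h0.symm
  have h2 : (1 : ℝ) ≤ Algebra.norm ℤ x := by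
    have : (0 : ℤ) < Algebra.norm ℤ x := by exact_mod_cast h1
    exact_mod_cast this
  rw [h] at h2
  exact (one_le_sq_iff₀ (norm_nonneg _)).1 h2

/-- A `ℤ`-basis of the ring of integers, with the discriminant expressed through an embedding. -/
theorem exists_two_basis : ∃ b₀ b₁ : 𝓞 K, (∀ x : 𝓞 K, ∃ i j : ℤ, x = i * b₀ + j * b₁) ∧
    (2 * ((σ b₀).im * (σ b₁).re - (σ b₀).re * (σ b₁).im)) ^ 2 = rootDisc K ^ 2 := by
  classical
  obtain ⟨e, h0, h1⟩ := exists_equiv σ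
  have hcard : Fintype.card (Module.Free.ChooseBasisIndex ℤ (𝓞 K)) = Fintype.card (Fin 2) := by
    rw [← Module.finrank_eq_card_chooseBasisIndex, RingOfIntegers.rank,
      Algebra.IsQuadraticExtension.finrank_eq_two, Fintype.card_fin]
  let g := Fintype.equivOfCardEq hcard
  let B := (RingOfIntegers.basis K).reindex g
  refine ⟨B 0, B 1, fun x => ⟨B.repr x 0, B.repr x 1, ?_⟩, ?_⟩
  · simpa only [Fin.sum_univ_two, zsmul_eq_mul] using (B.sum_repr x).symm
  have hd := Algebra.discr_eq_det_embeddingsMatrixReindex_pow_two ℚ ℂ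
    (fun i => (B i : K)) e
  have hB : (fun i => (B i : K)) = (integralBasis K) ∘ g.symm := by
    funext i
    simp [B]
  nth_rewrite 1 [hB] at hd
  rw [Algebra.discr_reindex, ← coe_discr, Matrix.det_fin_two] at hd
  simp only [Algebra.embeddingsMatrixReindex, Algebra.embeddingsMatrix, Matrix.reindex_apply,
    Matrix.submatrix_apply, Matrix.of_apply, Equiv.refl_symm, Equiv.symm_symm, Equiv.coe_refl,
    id, h0, h1, eq_ratCast, Rat.cast_intCast] at hd
  set u := σ (B 0)
  set v := σ (B 1)
  have htr : u * (starRingEnd ℂ) v - (starRingEnd ℂ) u * v =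
      ((2 * (u.im * v.re - u.re * v.im) : ℝ) : ℂ) * Complex.I := by
    apply Complex.ext
    · simp
    · simp
      ring
  rw [htr, mul_pow, Complex.I_sq] at hd
  have h3 : (discr K : ℝ) = -(2 * (u.im * v.re - u.re * v.im)) ^ 2 := by
    have : ((discr K : ℝ) : ℂ) = ((-(2 * (u.im * v.re - u.re * v.im)) ^ 2 : ℝ) : ℂ) := by
      push_cast
      push_cast at hd
      rw [hd]
      ring
    exact_mod_cast this
  rw [rootDisc_sq, h3, abs_neg, abs_of_nonneg (sq_nonneg _)]

/-- The ring of integers is `ℤ + ℤω` with `ω` of imaginary part `√|D| / 2`. -/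
theorem exists_omega : ∃ ω : 𝓞 K, (σ ω).im = rootDisc K / 2 ∧ |(σ ω).re| ≤ 1 / 2 ∧
    ∀ x : 𝓞 K, ∃ i j : ℤ, x = i + j * ω := by
  obtain ⟨b₀, b₁, hb, hdet⟩ := exists_two_basis σ
  obtain ⟨k₀, hk₀⟩ := exists_im_eq σ b₀
  obtain ⟨k₁, hk₁⟩ := exists_im_eq σ b₁
  obtain ⟨c₀, c₁, hc⟩ := hb 1
  have hs := rootDisc_pos (K := K)
  have hσ : ∀ i j : ℤ, σ ((i * b₀ + j * b₁ : 𝓞 K) : K) = i * σ b₀ + j * σ b₁ := by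
    intro i j
    simp
  have h1 : (1 : ℂ) = c₀ * σ b₀ + c₁ * σ b₁ := by
    rw [← hσ, ← hc]
    simp
  have hre : 1 = c₀ * (σ b₀).re + c₁ * (σ b₁).re := by
    simpa using congrArg Complex.re h1
  have him : 0 = c₀ * (σ b₀).im + c₁ * (σ b₁).im := by
    simpa using congrArg Complex.im h1
  rw [hk₀, hk₁] at him hdet
  set u := (σ b₀).re
  set v := (σ b₁).re
  have him' : (c₀ : ℝ) * k₀ + c₁ * k₁ = 0 := by
    have : ((c₀ : ℝ) * k₀ + c₁ * k₁) * (rootDisc K / 2) = 0 := by linarith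
    rcases mul_eq_zero.1 this with h | h
    · exact h
    · linarith
  have hdet' : ((k₀ : ℝ) * v - k₁ * u) ^ 2 = 1 := by
    have : (((k₀ : ℝ) * v - k₁ * u) ^ 2) * rootDisc K ^ 2 = 1 * rootDisc K ^ 2 := by
      rw [one_mul]
      nth_rewrite 2 [← hdet]
      ring
    exact mul_right_cancel₀ (by positivity) this
  -- A common divisor g of the coordinates of 1 would make 1/g an algebraic integer, and nonzero
  -- integers have absolute value at least 1.
  have hcop : IsCoprime c₀ c₁ := by
    rw [Int.isCoprime_iff_gcd_eq_one]
    obtain ⟨d₀, hd₀⟩ := Int.gcd_dvd_left (a := c₀) (b := c₁)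
    obtain ⟨d₁, hd₁⟩ := Int.gcd_dvd_right (a := c₀) (b := c₁)
    set g := Int.gcd c₀ c₁
    have h2 : (1 : 𝓞 K) = (g : 𝓞 K) * (d₀ * b₀ + d₁ * b₁) := by
      rw [hc, hd₀, hd₁]
      push_cast
      ring
    have h3 : (d₀ * b₀ + d₁ * b₁ : 𝓞 K) ≠ 0 := fun h => by simp [h] at h2
    have h4 := one_le_norm σ h3
    have h5 : (1 : ℝ) = g * ‖σ (d₀ * b₀ + d₁ * b₁ : 𝓞 K)‖ := by
      have := congrArg (fun x : 𝓞 K => ‖σ x‖) h2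
      simpa using this
    have h6 : (g : ℝ) ≤ 1 := by
      by_contra! h
      nlinarith
    have h7 : g ≤ 1 := by exact_mod_cast h6
    have h8 : g ≠ 0 := fun h => by simp [h] at h5
    omega
  -- The determinant condition makes (k₀, k₁) equal to ±(c₁, −c₀), so it is primitive too, and
  -- imaginary part s/2 is attained.
  have hkcop : ∃ p q : ℤ, p * k₀ + q * k₁ = 1 := by
    obtain ⟨p, q, hpq⟩ := hcop
    have e1 : (k₀ : ℝ) = c₁ * (k₀ * v - k₁ * u) := by
      linear_combination (k₀ : ℝ) * hre + u * him'
    have e2 : (k₁ : ℝ) = -c₀ * (k₀ * v - k₁ * u) := by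
      linear_combination (k₁ : ℝ) * hre + v * him'
    rcases (sq_eq_sq_iff_eq_or_eq_neg (b := (1 : ℝ))).1 (by rw [hdet', one_pow]) with h | h
    all_goals
      rw [h] at e1 e2
    · refine ⟨q, -p, ?_⟩
      have : ((q * k₀ + -p * k₁ : ℤ) : ℝ) = ((p * c₀ + q * c₁ : ℤ) : ℝ) := by
        push_cast
        rw [e1, e2]
        ring
      rw [← hpq]
      exact_mod_cast this
    · refine ⟨-q, p, ?_⟩
      have : ((-q * k₀ + p * k₁ : ℤ) : ℝ) = ((p * c₀ + q * c₁ : ℤ) : ℝ) := by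
        push_cast
        rw [e1, e2]
        ring
      rw [← hpq]
      exact_mod_cast this
  -- The integers of zero imaginary part are the multiples of one generator k₁b₀ − k₀b₁. Since 1 is
  -- among them, the size bound again forces this generator to be ±1.
  have hreal : ∀ y : 𝓞 K, (σ y).im = 0 → ∃ i : ℤ, y = i := by
    obtain ⟨p, q, hpq⟩ := hkcop
    have key : ∀ y : 𝓞 K, (σ y).im = 0 → ∃ t : ℤ, y = t * (k₁ * b₀ - k₀ * b₁) := by
      intro y hy
      obtain ⟨y₀, y₁, rfl⟩ := hb y
      rw [hσ] at hy
      have h2 : (y₀ : ℝ) * (k₀ * (rootDisc K / 2)) + y₁ * (k₁ * (rootDisc K / 2)) = 0 := by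
        rw [← hk₀, ← hk₁]
        simpa using hy
      have h3 : (y₀ : ℝ) * k₀ + y₁ * k₁ = 0 := by
        have : ((y₀ : ℝ) * k₀ + y₁ * k₁) * (rootDisc K / 2) = 0 := by linarith
        rcases mul_eq_zero.1 this with h | h
        · exact h
        · linarith
      have h4 : y₀ * k₀ + y₁ * k₁ = 0 := by exact_mod_cast h3
      have e1 : y₀ = (q * y₀ - p * y₁) * k₁ := by linear_combination p * h4 - y₀ * hpq
      have e2 : y₁ = -(q * y₀ - p * y₁) * k₀ := by linear_combination q * h4 - y₁ * hpq
      refine ⟨q * y₀ - p * y₁, ?_⟩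
      have e1' := congrArg (Int.cast : ℤ → 𝓞 K) e1
      have e2' := congrArg (Int.cast : ℤ → 𝓞 K) e2
      push_cast at e1' e2' ⊢
      linear_combination b₀ * e1' + b₁ * e2'
    obtain ⟨t₁, ht₁⟩ := key 1 (by simp)
    intro y hy
    obtain ⟨t, ht⟩ := key y hy
    have hne : (k₁ * b₀ - k₀ * b₁ : 𝓞 K) ≠ 0 := fun h => by simp [h] at ht₁
    have h4 := one_le_norm σ hne
    have h5 : (1 : ℝ) = |(t₁ : ℝ)| * ‖σ (k₁ * b₀ - k₀ * b₁ : 𝓞 K)‖ := by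
      have := congrArg (fun x : 𝓞 K => ‖σ x‖) ht₁
      simpa using this
    have h6 : |(t₁ : ℝ)| ≤ 1 := by
      by_contra! h
      nlinarith
    have h7 : |t₁| ≤ 1 := by exact_mod_cast h6
    have h8 : t₁ ≠ 0 := fun h => by simp [h] at h5
    have h9 : t₁ * t₁ = 1 := by
      have := abs_le.1 h7
      rcases (by omega : t₁ = 1 ∨ t₁ = -1) with h | h <;> rw [h] <;> norm_num
    refine ⟨t * t₁, ?_⟩
    have h10 : (t₁ : 𝓞 K) * t₁ = 1 := by exact_mod_cast congrArg (Int.cast : ℤ → 𝓞 K) h9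
    rw [ht]
    push_cast
    linear_combination -(t * t₁ : 𝓞 K) * ht₁ - (t * (k₁ * b₀ - k₀ * b₁) : 𝓞 K) * h10
  obtain ⟨p, q, hpq⟩ := hkcop
  set ω₀ : 𝓞 K := p * b₀ + q * b₁
  have hω₀ : (σ ω₀).im = rootDisc K / 2 := by
    have hpq' : (p : ℝ) * k₀ + q * k₁ = 1 := by exact_mod_cast hpq
    have : (σ ω₀).im = p * (k₀ * (rootDisc K / 2)) + q * (k₁ * (rootDisc K / 2)) := by
      rw [← hk₀, ← hk₁, hσ]
      simp
    rw [this]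
    linear_combination (rootDisc K / 2) * hpq'
  have hω : (σ ((ω₀ - (round (σ ω₀).re : ℤ) : 𝓞 K) : K)) = σ ω₀ - (round (σ ω₀).re : ℤ) := by
    simp
  refine ⟨ω₀ - (round (σ ω₀).re : ℤ), ?_, ?_, fun x => ?_⟩
  · rw [hω]
    simpa using hω₀
  · rw [hω]
    simpa using abs_sub_round (σ ω₀).re
  · obtain ⟨k, hk⟩ := exists_im_eq σ x
    obtain ⟨i, hi⟩ := hreal (x - k * ω₀) (by
      have : σ ((x - k * ω₀ : 𝓞 K) : K) = σ x - k * σ ω₀ := by simp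
      rw [this]
      simp [hk, hω₀])
    refine ⟨i + k * (round (σ ω₀).re : ℤ), k, ?_⟩
    push_cast
    linear_combination hi

theorem card_int_le (A : Finset ℤ) (c ρ : ℝ) (hA : ∀ i ∈ A, |(i : ℝ) - c| ≤ ρ) (hρ : 0 ≤ ρ) :
    (A.card : ℝ) ≤ 1 + 2 * ρ := by
  have hsub : A ⊆ Finset.Icc ⌈c - ρ⌉ ⌊c + ρ⌋ := by
    intro i hi
    have := abs_le.1 (hA i hi)
    rw [Finset.mem_Icc, Int.ceil_le, Int.le_floor]
    constructor <;> linarith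
  have h1 := Finset.card_le_card hsub
  rw [Int.card_Icc] at h1
  have h2 : (A.card : ℝ) ≤ ((⌊c + ρ⌋ + 1 - ⌈c - ρ⌉).toNat : ℝ) := by exact_mod_cast h1
  refine h2.trans ?_
  have h3 : (((⌊c + ρ⌋ + 1 - ⌈c - ρ⌉).toNat : ℤ) : ℝ) ≤ 1 + 2 * ρ := by
    rw [Int.toNat_eq_max]
    push_cast
    have := Int.floor_le (c + ρ)
    have := Int.le_ceil (c - ρ)
    apply max_le <;> linarith
  exact_mod_cast h3

/-- The number of algebraic integers in a disc of radius `ρ`. -/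
theorem card_ball_le (A : Finset (𝓞 K)) (c : ℂ) {ρ : ℝ} (hρ : 0 ≤ ρ)
    (hA : ∀ x ∈ A, ‖σ x - c‖ ≤ ρ) :
    (A.card : ℝ) ≤ 8 * (1 + ρ + ρ ^ 2 / rootDisc K) := by
  classical
  obtain ⟨ω, hω, -, hrep⟩ := exists_omega σ
  choose f g hfg using hrep
  have hs := one_le_rootDisc (K := K)
  have hσ : ∀ x : 𝓞 K, σ x = f x + g x * σ ω := fun x => by
    conv_lhs => rw [hfg x]
    simp
  have him : ∀ x : 𝓞 K, (σ x).im = g x * (rootDisc K / 2) := fun x => by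
    rw [hσ x, ← hω]
    simp
  have hre : ∀ x : 𝓞 K, (σ x).re = f x + g x * (σ ω).re := fun x => by
    rw [hσ x]
    simp
  -- The lattice is a union of horizontal rows at distance s/2, each a translate of ℤ; the rows are
  -- counted here and the points of one row in `hI`.
  have hJ : ((A.image g).card : ℝ) ≤ 1 + 2 * (2 * ρ / rootDisc K) := by
    refine card_int_le _ (2 * c.im / rootDisc K) _ (fun j hj => ?_) (by positivity)
    obtain ⟨x, hx, rfl⟩ := Finset.mem_image.1 hj
    have h1 := (Complex.abs_im_le_norm _).trans (hA x hx)
    rw [Complex.sub_im, him] at h1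
    have h2 : (g x : ℝ) - 2 * c.im / rootDisc K =
        (g x * (rootDisc K / 2) - c.im) * (2 / rootDisc K) := by
      field_simp
    rw [h2, abs_mul, abs_of_pos (by positivity : 0 < 2 / rootDisc K)]
    calc _ ≤ ρ * (2 / rootDisc K) := by gcongr
      _ = _ := by ring
  have hI : ∀ j ∈ A.image g, (((A.filter fun x => g x = j).card : ℕ) : ℝ) ≤ 1 + 2 * ρ := by
    intro j _
    have hinj : Set.InjOn f (A.filter fun x => g x = j : Finset (𝓞 K)) := by
      intro x hx y hy hxy
      simp only [Finset.coe_filter, Set.mem_ofPred_eq] at hx hy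
      rw [hfg x, hfg y, hx.2, hy.2, hxy]
    rw [← Finset.card_image_of_injOn hinj]
    refine card_int_le _ (c.re - j * (σ ω).re) _ (fun i hi => ?_) hρ
    obtain ⟨x, hx, rfl⟩ := Finset.mem_image.1 hi
    rw [Finset.mem_filter] at hx
    have h1 := (Complex.abs_re_le_norm _).trans (hA x hx.1)
    rw [Complex.sub_re, hre, hx.2] at h1
    rwa [show (f x : ℝ) - (c.re - j * (σ ω).re) = f x + j * (σ ω).re - c.re by ring]
  have hcard : (A.card : ℝ) = ∑ j ∈ A.image g, (((A.filter fun x => g x = j).card : ℕ) : ℝ) := by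
    exact_mod_cast Finset.card_eq_sum_card_image g A
  have h1 : (A.card : ℝ) ≤ (1 + 2 * (2 * ρ / rootDisc K)) * (1 + 2 * ρ) := by
    rw [hcard]
    refine (Finset.sum_le_card_nsmul _ _ _ hI).trans ?_
    rw [nsmul_eq_mul]
    gcongr
  have h2 : ρ / rootDisc K ≤ ρ := div_le_self hρ hs
  calc _ ≤ _ := h1
    _ = 1 + 2 * ρ + 4 * (ρ / rootDisc K) + 8 * (ρ ^ 2 / rootDisc K) := by ring
    _ ≤ _ := by linarith

/-- The number of members of a residue class modulo `g` in a disc of radius `ρ`. -/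
theorem card_congr_ball_le (A : Finset (𝓞 K)) (c : ℂ) {ρ : ℝ} (hρ : 0 ≤ ρ) {g : 𝓞 K}
    (hg : g ≠ 0) (hA : ∀ x ∈ A, ‖σ x - c‖ ≤ ρ) (hdvd : ∀ x ∈ A, ∀ y ∈ A, g ∣ x - y) :
    (A.card : ℝ) ≤ 8 * (1 + ρ / ‖σ g‖ + (ρ / ‖σ g‖) ^ 2 / rootDisc K) := by
  classical
  rcases A.eq_empty_or_nonempty with rfl | ⟨x₀, hx₀⟩
  · have := rootDisc_pos (K := K)
    simp only [Finset.card_empty, Nat.cast_zero]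
    positivity
  have hg0 := map_coe_ne_zero σ hg
  choose! f hf using fun x (hx : x ∈ A) => hdvd x hx x₀ hx₀
  have hinj : Set.InjOn f A := fun x hx y hy hxy => by
    have h1 := hf x hx
    rw [hxy, ← hf y hy] at h1
    exact sub_left_injective h1
  rw [← Finset.card_image_of_injOn hinj]
  refine card_ball_le σ _ ((c - σ x₀) / σ g) (by positivity) fun y hy => ?_
  obtain ⟨x, hx, rfl⟩ := Finset.mem_image.1 hy
  have h1 : σ (f x) - (c - σ x₀) / σ g = (σ x - c) / σ g := by
    have : σ x - σ x₀ = σ g * σ (f x) := by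
      rw [← map_sub, ← map_mul]
      exact congrArg (fun z : 𝓞 K => σ z) (hf x hx)
    field_simp
    linear_combination -this
  rw [h1, norm_div]
  gcongr
  exact hA x hx

/-- The quotient 4m/H is a nonzero integer of absolute value at most 4M/|H|, so this radius is at
least 1 and absorbs the constant term of the disc count. Without m ≠ 0 the saving of the factor |H|
would fail. The factor 4 matches the divisibility h² ∣ 4m. -/
theorem card_multiples_le (A : Finset (𝓞 K)) {M : ℝ} (hM : 0 ≤ M) {H : 𝓞 K} (hH : H ≠ 0)
    (hA : ∀ m ∈ A, m ≠ 0 ∧ ‖σ m‖ ≤ M ∧ H ∣ 4 * m) :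
    (A.card : ℝ) * ‖σ H‖ ≤ 256 * (M + M ^ 2 / rootDisc K) := by
  classical
  have hs := rootDisc_pos (K := K)
  rcases A.eq_empty_or_nonempty with rfl | ⟨m₀, hm₀⟩
  · simp only [Finset.card_empty, Nat.cast_zero, zero_mul]
    positivity
  choose! f hf using fun m (hm : m ∈ A) => (hA m hm).2.2
  have hH1 := one_le_norm σ hH
  have hH0 : 0 < ‖σ H‖ := by linarith
  have h4 : (4 : 𝓞 K) ≠ 0 := by norm_num
  have hfne : ∀ m ∈ A, f m ≠ 0 := fun m hm h => by
    have := hf m hm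
    rw [h, mul_zero] at this
    exact mul_ne_zero h4 (hA m hm).1 this
  have hfle : ∀ m ∈ A, ‖σ (f m) - 0‖ ≤ 4 * M / ‖σ H‖ := fun m hm => by
    rw [sub_zero, le_div_iff₀ hH0]
    have := congrArg (fun x : 𝓞 K => ‖σ x‖) (hf m hm)
    simp only [map_mul, norm_mul, map_ofNat, Complex.norm_ofNat] at this
    linarith [(hA m hm).2.1]
  have hinj : Set.InjOn f A := fun x hx y hy hxy => by
    have h1 := hf x hx
    rw [hxy, ← hf y hy] at h1
    exact mul_left_cancel₀ h4 h1
  have hone : 1 ≤ 4 * M / ‖σ H‖ := by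
    have := hfle m₀ hm₀
    rw [sub_zero] at this
    exact (one_le_norm σ (hfne m₀ hm₀)).trans this
  have hcard := card_ball_le σ (A.image f) 0 (ρ := 4 * M / ‖σ H‖) (by positivity) (fun y hy => by
    obtain ⟨x, hx, rfl⟩ := Finset.mem_image.1 hy
    exact hfle x hx)
  rw [Finset.card_image_of_injOn hinj] at hcard
  have hsq : (4 * M / ‖σ H‖) ^ 2 / rootDisc K * ‖σ H‖ ≤ 16 * (M ^ 2 / rootDisc K) := by
    have h1 : (4 * M / ‖σ H‖) ^ 2 / rootDisc K * ‖σ H‖ = 16 * (M ^ 2 / rootDisc K) / ‖σ H‖ := by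
      field_simp
      ring
    rw [h1]
    exact div_le_self (by positivity) hH1
  have hlin : 4 * M / ‖σ H‖ * ‖σ H‖ = 4 * M := by field_simp
  calc (A.card : ℝ) * ‖σ H‖
      ≤ 8 * (4 * M / ‖σ H‖ + 4 * M / ‖σ H‖ + (4 * M / ‖σ H‖) ^ 2 / rootDisc K) * ‖σ H‖ := by
        refine mul_le_mul_of_nonneg_right (hcard.trans ?_) hH0.le
        linarith
    _ = 16 * (4 * M / ‖σ H‖ * ‖σ H‖) + 8 * ((4 * M / ‖σ H‖) ^ 2 / rootDisc K * ‖σ H‖) := by ring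
    _ ≤ 16 * (4 * M) + 8 * (16 * (M ^ 2 / rootDisc K)) := by rw [hlin]; gcongr
    _ ≤ _ := by
      have : 0 ≤ M ^ 2 / rootDisc K := by positivity
      linarith

end Lattice

/-! ### Diophantine approximation by the box principle -/

section Dirichlet

variable {K : Type*} [Field K] [NumberField K] [Algebra.IsQuadraticExtension ℚ K]
  [IsTotallyComplex K] (σ : K →+* ℂ)

theorem exists_coordinates {ω : ℂ} (hω : ω.im ≠ 0) (z : ℂ) : ∃ u v : ℝ, z = u + v * ω := by
  refine ⟨z.re - z.im / ω.im * ω.re, z.im / ω.im, ?_⟩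
  apply Complex.ext
  · simp
  · simp [hω]

theorem abs_sub_le_of_floor_mul_eq {a b u : ℝ} (hu : 0 < u) (h : ⌊u * a⌋ = ⌊u * b⌋) :
    |a - b| ≤ 1 / u := by
  have h1 := Int.abs_sub_lt_one_of_floor_eq_floor h
  rw [← mul_sub, abs_mul, abs_of_pos hu] at h1
  rw [le_div_iff₀ hu]
  linarith

/-- Dirichlet's approximation theorem over an imaginary quadratic field, uniform in the field. -/
theorem exists_approx (x : ℂ) {T : ℝ} (hT : 1 ≤ T) : ∃ r b : 𝓞 K, r ≠ 0 ∧ ‖σ r‖ ≤ 2 * T ∧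
    ‖σ r * x - σ b‖ ≤ 3 * rootDisc K / T := by
  obtain ⟨ω, hω, hωre, hrep⟩ := exists_omega σ
  have hs := one_le_rootDisc (K := K)
  have hs0 := rootDisc_pos (K := K)
  have hωne : (σ ω).im ≠ 0 := by rw [hω]; positivity
  have hωnorm : ‖σ ω‖ ≤ rootDisc K := by
    refine (Complex.norm_le_abs_re_add_abs_im _).trans ?_
    rw [hω, abs_of_pos (by positivity : 0 < rootDisc K / 2)]
    linarith
  choose u v huv using fun p : ℕ × ℕ => exists_coordinates hωne ((p.1 + p.2 * σ ω) * x)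
  set I := ⌊T⌋₊ with hI
  set J := ⌊T / rootDisc K⌋₊ with hJ
  have hI1 : 1 ≤ I := Nat.le_floor (by simpa using hT)
  have hIle : (I : ℝ) ≤ T := Nat.floor_le (by linarith)
  have hJle : (J : ℝ) ≤ T / rootDisc K := Nat.floor_le (by positivity)
  have hTI : T ≤ 2 * I := by
    have := Nat.lt_floor_add_one T
    have : (1 : ℝ) ≤ I := by exact_mod_cast hI1
    linarith
  have hTJ : T / rootDisc K ≤ J + 1 := (Nat.lt_floor_add_one _).le
  have hIpos : (0 : ℝ) < I := by exact_mod_cast hI1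
  -- There are (I + 1)(J + 1) multipliers i + jω and (J + 1)·I boxes. The side lengths are unequal
  -- because |ω| may be as large as s: the error is at most 1/(J + 1) ≤ s/T along 1 and s/I ≤ 2s/T
  -- along ω. Using J + 1 parts also covers J = 0, which occurs for T < s.
  let F : ℕ × ℕ → ℤ × ℤ := fun p => (⌊(J + 1 : ℝ) * Int.fract (u p)⌋, ⌊(I : ℝ) * Int.fract (v p)⌋)
  have hmaps : ∀ p ∈ Finset.range (I + 1) ×ˢ Finset.range (J + 1),
      F p ∈ Finset.Ico (0 : ℤ) (J + 1) ×ˢ Finset.Ico (0 : ℤ) I := by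
    intro p _
    have h1 : ∀ (k t : ℝ), 0 < k → 0 ≤ k * Int.fract t ∧ k * Int.fract t < k := fun k t hk =>
      ⟨mul_nonneg hk.le (Int.fract_nonneg t), by
        have := mul_lt_mul_of_pos_left (Int.fract_lt_one t) hk
        linarith⟩
    have h2 := h1 (J + 1) (u p) (by positivity)
    have h3 := h1 I (v p) hIpos
    simp only [F, Finset.mem_product, Finset.mem_Ico]
    refine ⟨⟨Int.floor_nonneg.2 h2.1, ?_⟩, ⟨Int.floor_nonneg.2 h3.1, ?_⟩⟩
    · rw [Int.floor_lt]
      push_cast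
      exact h2.2
    · rw [Int.floor_lt]
      push_cast
      exact h3.2
  obtain ⟨p, hp, p', hp', hne, heq⟩ := Finset.exists_ne_map_eq_of_card_lt_of_maps_to
    (s := Finset.range (I + 1) ×ˢ Finset.range (J + 1))
    (t := Finset.Ico (0 : ℤ) (J + 1) ×ˢ Finset.Ico (0 : ℤ) I) (by
      simp only [Finset.card_product, Int.card_Ico, Finset.card_range]
      have : ((J : ℤ) + 1 - 0).toNat = J + 1 := by omega
      have h2 : ((I : ℤ) - 0).toNat = I := by omega
      rw [this, h2]
      nlinarith) hmaps
  simp only [F, Prod.mk.injEq] at heq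
  have hu := abs_sub_le_of_floor_mul_eq (by positivity) heq.1
  have hv := abs_sub_le_of_floor_mul_eq hIpos heq.2
  simp only [Finset.mem_product, Finset.mem_range] at hp hp'
  refine ⟨((p.1 : 𝓞 K) - p'.1) + (p.2 - p'.2) * ω,
    ((⌊u p⌋ : ℤ) - (⌊u p'⌋ : ℤ) : 𝓞 K) + ((⌊v p⌋ : ℤ) - (⌊v p'⌋ : ℤ)) * ω, ?_, ?_, ?_⟩
  · intro h
    have h1 : ((p.1 : ℂ) - p'.1) + (p.2 - p'.2) * σ ω = 0 := by
      have := congrArg (fun z : 𝓞 K => σ z) h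
      simpa using this
    have h2 : ((p.2 : ℝ) - p'.2) * (σ ω).im = 0 := by
      simpa using congrArg Complex.im h1
    have h3 : (p.2 : ℝ) - p'.2 = 0 := by simpa [hωne] using h2
    have h4 : (p.1 : ℝ) - p'.1 = 0 := by
      have := congrArg Complex.re h1
      simp at this
      rw [h3] at this
      simpa using this
    exact hne (Prod.ext (by exact_mod_cast sub_eq_zero.1 h4) (by exact_mod_cast sub_eq_zero.1 h3))
  · have h1 : ∀ {a b k : ℕ}, a < k + 1 → b < k + 1 → ‖(a : ℂ) - b‖ ≤ k := by
      intro a b k ha hb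
      have : (a : ℂ) - b = ((a - b : ℝ) : ℂ) := by push_cast; rfl
      rw [this, Complex.norm_real, Real.norm_eq_abs, abs_le]
      have : (a : ℝ) ≤ k := by exact_mod_cast Nat.lt_succ_iff.1 ha
      have : (b : ℝ) ≤ k := by exact_mod_cast Nat.lt_succ_iff.1 hb
      have : (0 : ℝ) ≤ a := by positivity
      have : (0 : ℝ) ≤ b := by positivity
      constructor <;> linarith
    have h2 : σ (((p.1 : 𝓞 K) - p'.1 + (p.2 - p'.2) * ω : 𝓞 K) : K) =
        ((p.1 : ℂ) - p'.1) + (p.2 - p'.2) * σ ω := by simp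
    rw [h2]
    calc _ ≤ ‖(p.1 : ℂ) - p'.1‖ + ‖(p.2 : ℂ) - p'.2‖ * ‖σ ω‖ := by
          rw [← norm_mul]
          exact norm_add_le _ _
      _ ≤ T + T / rootDisc K * rootDisc K := by
          gcongr
          · exact (h1 hp.1 hp'.1).trans hIle
          · exact (h1 hp.2 hp'.2).trans hJle
      _ = 2 * T := by field_simp; ring
  · have h2 : σ (((p.1 : 𝓞 K) - p'.1 + (p.2 - p'.2) * ω : 𝓞 K) : K) * x -
        σ ((((⌊u p⌋ : ℤ) - (⌊u p'⌋ : ℤ) : 𝓞 K) + ((⌊v p⌋ : ℤ) - (⌊v p'⌋ : ℤ)) * ω : 𝓞 K) : K) =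
        ((Int.fract (u p) - Int.fract (u p') : ℝ) : ℂ) +
          ((Int.fract (v p) - Int.fract (v p') : ℝ) : ℂ) * σ ω := by
      have e1 := huv p
      have e2 := huv p'
      simp only [Int.fract]
      push_cast
      simp only [map_add, map_sub, map_mul, map_natCast, map_intCast]
      linear_combination e1 - e2
    rw [h2]
    calc _ ≤ |Int.fract (u p) - Int.fract (u p')| + |Int.fract (v p) - Int.fract (v p')| * ‖σ ω‖ := by
          refine (norm_add_le _ _).trans ?_
          rw [norm_mul, Complex.norm_real, Complex.norm_real, Real.norm_eq_abs, Real.norm_eq_abs]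
      _ ≤ 1 / (J + 1) + 1 / I * rootDisc K := by gcongr
      _ ≤ 1 / (T / rootDisc K) + 1 / (T / 2) * rootDisc K := by
          gcongr
          linarith
      _ = _ := by field_simp; ring

end Dirichlet

/-! ### Roots of a quadratic congruence in a principal ideal domain -/

section Principal

variable {R : Type*} [CommRing R] [IsDomain R] [IsPrincipalIdealRing R]

theorem exists_coprime_quotients (a b : R) (h : a ≠ 0) :
    ∃ g a' b' : R, a = g * a' ∧ b = g * b' ∧ IsCoprime a' b' := by
  obtain ⟨x, y, hxy⟩ := IsBezout.gcd_eq_sum a b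
  obtain ⟨a', ha⟩ := IsBezout.gcd_dvd_left a b
  obtain ⟨b', hb⟩ := IsBezout.gcd_dvd_right a b
  have hg : IsBezout.gcd a b ≠ 0 := fun h0 => h (by rw [ha, h0, zero_mul])
  refine ⟨IsBezout.gcd a b, a', b', ha, hb, x, y, mul_left_cancel₀ hg ?_⟩
  linear_combination hxy - x * ha - y * hb

/-- The solutions `q` of `b q² + m ≡ 0 mod r` for which `q - q₀` and `r` generate a given ideal lie
in one residue class modulo a divisor `g` of `r` whose codivisor `h` satisfies `h² ∣ 4 m`. -/
theorem exists_modulus {r : R} (hr : r ≠ 0) {I : Ideal R} (hI : r ∈ I) :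
    ∃ h g : R, r = h * g ∧ ∀ b m q₀ q₁ q₂ : R, IsCoprime b r → r ∣ b * q₀ ^ 2 + m →
      r ∣ b * q₁ ^ 2 + m → r ∣ b * q₂ ^ 2 + m → Ideal.span {q₁ - q₀, r} = I →
      Ideal.span {q₂ - q₀, r} = I → g ∣ q₁ - q₂ ∧ h ^ 2 ∣ 4 * m := by
  obtain ⟨d, hd⟩ := IsPrincipalIdealRing.principal I
  have hd' : I = Ideal.span {d} := hd
  subst hd'
  obtain ⟨e, rfl⟩ := Ideal.mem_span_singleton.1 hI
  have hd0 : d ≠ 0 := left_ne_zero_of_mul hr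
  obtain ⟨h, d', e', rfl, rfl, hcop⟩ := exists_coprime_quotients d e hd0
  -- Write the ideal as (d), r = de and q − q₀ = ds. Equality of ideals makes s coprime to e, so r ∣
  -- b(q − q₀)(q + q₀) forces e ∣ q + q₀. Thus q ≡ q₀ mod d and q ≡ −q₀ mod e, where d = hd', e =
  -- he' and d', e' are coprime.
  have key : ∀ b m q₀ q : R, IsCoprime b (h * d' * (h * e')) →
      h * d' * (h * e') ∣ b * q₀ ^ 2 + m → h * d' * (h * e') ∣ b * q ^ 2 + m →
      Ideal.span {q - q₀, h * d' * (h * e')} = Ideal.span {h * d'} →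
      h * d' ∣ q - q₀ ∧ h * e' ∣ q + q₀ := by
    intro b m q₀ q hb h0 h1 hspan
    have hmem : q - q₀ ∈ Ideal.span {h * d'} := by
      rw [← hspan]
      exact Ideal.subset_span (by simp)
    obtain ⟨s, hs⟩ := Ideal.mem_span_singleton.1 hmem
    refine ⟨⟨s, hs⟩, ?_⟩
    have hd1 : h * d' ∈ Ideal.span {q - q₀, h * d' * (h * e')} := by
      rw [hspan]
      exact Ideal.mem_span_singleton_self _
    obtain ⟨x, y, hxy⟩ := Ideal.mem_span_pair.1 hd1
    have hse : IsCoprime (h * e') s := by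
      refine ⟨y, x, mul_left_cancel₀ hd0 ?_⟩
      linear_combination hxy - x * hs
    have hdiff : h * d' * (h * e') ∣ b * ((q - q₀) * (q + q₀)) := by
      have := dvd_sub h1 h0
      rwa [show b * q ^ 2 + m - (b * q₀ ^ 2 + m) = b * ((q - q₀) * (q + q₀)) by ring] at this
    have h2 := hb.symm.dvd_of_dvd_mul_left hdiff
    rw [hs, mul_assoc (h * d') s] at h2
    exact hse.dvd_of_dvd_mul_left ((mul_dvd_mul_iff_left hd0).1 h2)
  refine ⟨h, h * d' * e', by ring, fun b m q₀ q₁ q₂ hb h0 h1 h2 hI1 hI2 => ?_⟩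
  obtain ⟨⟨x, hx⟩, y, hy⟩ := key b m q₀ q₁ hb h0 h1 hI1
  obtain ⟨⟨x', hx'⟩, y', hy'⟩ := key b m q₀ q₂ hb h0 h2 hI2
  have hh0 : h ≠ 0 := left_ne_zero_of_mul hd0
  constructor
  · have e1 : q₁ - q₂ = h * (d' * (x - x')) := by linear_combination hx - hx'
    have e2 : q₁ - q₂ = h * (e' * (y - y')) := by linear_combination hy - hy'
    have e3 : d' * (x - x') = e' * (y - y') := mul_left_cancel₀ hh0 (e1.symm.trans e2)
    obtain ⟨t, ht⟩ := hcop.symm.dvd_of_dvd_mul_left ⟨_, e3⟩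
    exact ⟨t, by rw [e1, ht]; ring⟩
  -- Adding the two congruences gives h ∣ 2q₁; since h² ∣ r, the congruence for q₁ multiplied by 4
  -- gives h² ∣ 4m.
  · obtain ⟨k, hk⟩ := h1
    exact ⟨4 * (d' * e' * k) - b * (d' * x + e' * y) ^ 2, by
      have e : 2 * q₁ = h * (d' * x + e' * y) := by linear_combination hx + hy
      linear_combination 4 * hk - b * (2 * q₁ + h * (d' * x + e' * y)) * e⟩

end Principal

/-! ### The divisor bound, uniform in the field -/

section Divisors

/-- One Euler factor of the divisor bound. A prime of norm w > 2^{1/ε} has w^ε ≥ 2 and costs no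
constant because e + 1 ≤ 2^e; only the smaller primes contribute a constant. -/
theorem add_one_le_mul_rpow {ε : ℝ} (hε : 0 < ε) {w : ℝ} (hw : 2 ≤ w) (e : ℕ) :
    ((e + 1 : ℕ) : ℝ) ≤ (if w ≤ 2 ^ (1 / ε) then max 1 (1 / (ε * Real.log 2)) else 1) *
      (w ^ e) ^ ε := by
  have hlog : 0 < Real.log 2 := Real.log_pos (by norm_num)
  have hw0 : 0 < w := by linarith
  split_ifs with h
  · have h1 : ((2 : ℝ) ^ e) ^ ε ≤ (w ^ e) ^ ε := by gcongr
    have h2 : 1 + ε * Real.log 2 * e ≤ ((2 : ℝ) ^ e) ^ ε := by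
      rw [← Real.rpow_natCast, ← Real.rpow_mul (by norm_num), Real.rpow_def_of_pos (by norm_num)]
      have := Real.add_one_le_exp (Real.log 2 * (e * ε))
      linarith
    have h3 : (1 : ℝ) ≤ max 1 (1 / (ε * Real.log 2)) := le_max_left _ _
    have h4 : 1 ≤ max 1 (1 / (ε * Real.log 2)) * (ε * Real.log 2) := by
      rw [← div_le_iff₀ (by positivity)]
      exact le_max_right _ _
    calc ((e + 1 : ℕ) : ℝ) = 1 + 1 * e := by push_cast; ring
      _ ≤ max 1 (1 / (ε * Real.log 2)) +
          max 1 (1 / (ε * Real.log 2)) * (ε * Real.log 2) * e := by gcongr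
      _ = max 1 (1 / (ε * Real.log 2)) * (1 + ε * Real.log 2 * e) := by ring
      _ ≤ _ := by
        gcongr
        exact h2.trans h1
  · have h1 : (2 : ℝ) ≤ w ^ ε := by
      calc (2 : ℝ) = (2 ^ (1 / ε)) ^ ε := by
            rw [← Real.rpow_mul (by norm_num), one_div_mul_cancel hε.ne', Real.rpow_one]
        _ ≤ w ^ ε := by
            have := not_le.1 h
            gcongr
    rw [one_mul, ← Real.rpow_natCast, ← Real.rpow_mul hw0.le, mul_comm (e : ℝ), Real.rpow_mul hw0.le,
      Real.rpow_natCast]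
    calc ((e + 1 : ℕ) : ℝ) ≤ 2 ^ e := by exact_mod_cast Nat.lt_two_pow_self
      _ ≤ _ := by gcongr

theorem card_Iic_multiset_le {α : Type*} [DecidableEq α] {ε : ℝ} (hε : 0 < ε) (w : α → ℝ)
    (t : Multiset α) (hw : ∀ p ∈ t, 2 ≤ w p) {k : ℝ}
    (hk : ∀ A : Finset α, (∀ p ∈ A, p ∈ t ∧ w p ≤ 2 ^ (1 / ε)) → (A.card : ℝ) ≤ k) :
    ((Finset.Iic t).card : ℝ) ≤ max 1 (1 / (ε * Real.log 2)) ^ k * (t.map w).prod ^ ε := by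
  classical
  rw [Multiset.card_Iic, Nat.cast_prod]
  calc _ ≤ ∏ p ∈ t.toFinset, ((if w p ≤ 2 ^ (1 / ε) then max 1 (1 / (ε * Real.log 2)) else 1) *
        (w p ^ t.count p) ^ ε) := by
        refine Finset.prod_le_prod (fun _ _ => by positivity) fun p hp => ?_
        exact add_one_le_mul_rpow hε (hw p (Multiset.mem_toFinset.1 hp)) _
    _ = max 1 (1 / (ε * Real.log 2)) ^ (t.toFinset.filter fun p => w p ≤ 2 ^ (1 / ε)).card *
        (t.map w).prod ^ ε := by
        rw [Finset.prod_mul_distrib, Finset.prod_ite, Finset.prod_const, Finset.prod_const_one,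
          mul_one, Finset.prod_multiset_map_count, Real.finsetProd_rpow]
        intro p hp
        have := hw p (Multiset.mem_toFinset.1 hp)
        positivity
    _ ≤ _ := by
        have hnn : 0 ≤ (t.map w).prod := by
          refine Multiset.prod_nonneg fun x hx => ?_
          obtain ⟨p, hp, rfl⟩ := Multiset.mem_map.1 hx
          linarith [hw p hp]
        refine mul_le_mul_of_nonneg_right ?_ (by positivity)
        rw [← Real.rpow_natCast]
        refine Real.rpow_le_rpow_of_exponent_le (le_max_left _ _) (hk _ fun p hp => ?_)
        simpa using hp

/-- The divisor bound, uniform over the imaginary quadratic fields of class number one. -/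
theorem exists_card_divisors_le {ε : ℝ} (hε : 0 < ε) : ∃ C : ℝ, 0 < C ∧
    ∀ (K : Type*) [Field K] [NumberField K] [Algebra.IsQuadraticExtension ℚ K]
      [IsTotallyComplex K], classNumber K = 1 → ∀ (σ : K →+* ℂ) (r : 𝓞 K), r ≠ 0 →
      ∃ Δ : Finset (Ideal (𝓞 K)), (∀ I, r ∈ I ↔ I ∈ Δ) ∧ (Δ.card : ℝ) ≤ C * (‖σ r‖ ^ 2) ^ ε := by
  classical
  set X : ℝ := 2 ^ (1 / ε) with hX
  -- The exponent bounds the number of prime ideals of norm at most X: their generators are distinct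
  -- integers in the disc of radius √X, and s ≥ 1 removes the dependence on the field.
  refine ⟨max 1 (1 / (ε * Real.log 2)) ^ (8 * (1 + Real.sqrt X + X)), by positivity, ?_⟩
  intro K _ _ _ _ hK σ r hr
  have hpid := classNumber_eq_one_iff.1 hK
  have hI0 : Ideal.span {r} ≠ ⊥ := by simpa using hr
  set t := UniqueFactorizationMonoid.normalizedFactors (Ideal.span {r}) with ht
  have hle : ∀ I : Ideal (𝓞 K), r ∈ I ↔
      I ≠ ⊥ ∧ UniqueFactorizationMonoid.normalizedFactors I ≤ t := by
    intro I
    rw [← Ideal.span_singleton_le_iff_mem, ← Ideal.dvd_iff_le]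
    constructor
    · intro h
      have h0 := ne_zero_of_dvd_ne_zero hI0 h
      exact ⟨h0, (UniqueFactorizationMonoid.dvd_iff_normalizedFactors_le_normalizedFactors h0
        hI0).1 h⟩
    · rintro ⟨h0, h⟩
      exact (UniqueFactorizationMonoid.dvd_iff_normalizedFactors_le_normalizedFactors h0 hI0).2 h
  have hinj : Set.InjOn (UniqueFactorizationMonoid.normalizedFactors (α := Ideal (𝓞 K)))
      {I | r ∈ I} := by
    intro I hI J hJ hIJ
    rw [← associated_iff_eq]
    exact (UniqueFactorizationMonoid.associated_iff_normalizedFactors_eq_normalizedFactors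
      ((hle I).1 hI).1 ((hle J).1 hJ).1).2 hIJ
  have hfin : {I : Ideal (𝓞 K) | r ∈ I}.Finite :=
    Set.Finite.of_finite_image ((Finset.Iic t).finite_toSet.subset (by
      rintro _ ⟨I, hI, rfl⟩
      simpa using ((hle I).1 hI).2)) hinj
  refine ⟨hfin.toFinset, fun I => by simp, ?_⟩
  have hcard : hfin.toFinset.card ≤ (Finset.Iic t).card := by
    refine Finset.card_le_card_of_injOn (UniqueFactorizationMonoid.normalizedFactors)
      (fun I hI => ?_) (by simpa using hinj)
    simpa using ((hle I).1 (by simpa using hI)).2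
  have hgen : ∀ I : Ideal (𝓞 K), ∃ g : 𝓞 K, I = Ideal.span {g} ∧
      (Ideal.absNorm I : ℝ) = ‖σ g‖ ^ 2 := by
    intro I
    obtain ⟨g, hg⟩ := IsPrincipalIdealRing.principal I
    refine ⟨g, hg, ?_⟩
    have hg' : I = Ideal.span {g} := hg
    have h1 := norm_eq_sq σ g
    rw [hg', Ideal.absNorm_span_singleton, Nat.cast_natAbs, Int.cast_abs, h1,
      abs_of_nonneg (by positivity)]
  have hmain := card_Iic_multiset_le hε (fun I : Ideal (𝓞 K) => (Ideal.absNorm I : ℝ)) t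
    (fun p hp => by
      have hprime := UniqueFactorizationMonoid.prime_of_normalized_factor p hp
      have h1 : Ideal.absNorm p ≠ 1 := fun h => hprime.not_isUnit
        (Ideal.isUnit_iff.2 (Ideal.absNorm_eq_one_iff.1 h))
      have h0 : Ideal.absNorm p ≠ 0 := fun h => hprime.ne_zero (Ideal.absNorm_eq_zero_iff.1 h)
      exact_mod_cast (by omega : 2 ≤ Ideal.absNorm p)) (k := 8 * (1 + Real.sqrt X + X))
    (fun A hA => by
      choose g hg hgn using hgen
      have hginj : Set.InjOn g A := fun I _ J _ hIJ => by rw [hg I, hg J, hIJ]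
      rw [← Finset.card_image_of_injOn hginj]
      refine (card_ball_le σ (A.image g) 0 (ρ := Real.sqrt X) (by positivity) fun x hx => ?_).trans ?_
      · obtain ⟨I, hI, rfl⟩ := Finset.mem_image.1 hx
        rw [sub_zero]
        apply Real.le_sqrt_of_sq_le
        rw [← hgn]
        exact (hA I hI).2
      · rw [Real.sq_sqrt (by positivity)]
        gcongr
        exact div_le_self (by positivity) one_le_rootDisc)
  have hprod : (t.map fun I : Ideal (𝓞 K) => (Ideal.absNorm I : ℝ)).prod = ‖σ r‖ ^ 2 := by
    have h1 : (t.map fun I : Ideal (𝓞 K) => (Ideal.absNorm I : ℝ)).prod =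
        (Ideal.absNorm t.prod : ℝ) := by
      rw [map_multiset_prod, Nat.cast_multiset_prod, Multiset.map_map]
      rfl
    rw [h1, ht, associated_iff_eq.1 (UniqueFactorizationMonoid.prod_normalizedFactors hI0),
      Ideal.absNorm_span_singleton, Nat.cast_natAbs, Int.cast_abs, norm_eq_sq σ r,
      abs_of_nonneg (by positivity)]
  rw [hprod] at hmain
  exact le_trans (by exact_mod_cast hcard) hmain

end Divisors

/-! ### Duality and Parseval's identity in a finite residue ring -/

section LargeSieve

variable {K : Type*} [Field K] [NumberField K] (σ : K →+* ℂ)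

/-- The value at `x` of the character `x ↦ ẽ_K(n x / W)` of the residue ring modulo `W`. -/
noncomputable def modChar (W : ℕ) (n x : 𝓞 K) : ℂ := addChar K (σ n * (σ x / W))

theorem modChar_add (W : ℕ) (n x y : 𝓞 K) :
    modChar σ W n (x + y) = modChar σ W n x * modChar σ W n y := by
  rw [modChar, modChar, modChar, ← addChar_add]
  congr 1
  simp only [map_add]
  ring

theorem modChar_mul_conj (W : ℕ) (n n' x : 𝓞 K) :
    modChar σ W n x * (starRingEnd ℂ) (modChar σ W n' x) = modChar σ W (n - n') x := by
  rw [modChar, modChar, modChar, conj_addChar, ← addChar_add]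
  congr 1
  simp only [map_sub]
  ring

/-- The phase is 2·Im z/s turns; the size condition keeps it below one full turn, so it can be an
integer only if it vanishes. -/
theorem im_eq_zero_of_addChar_eq_one {z : ℂ} (hz : 2 * ‖z‖ < rootDisc K) (h : addChar K z = 1) :
    z.im = 0 := by
  have hs := rootDisc_pos (K := K)
  rw [addChar, Complex.exp_eq_one_iff] at h
  obtain ⟨k, hk⟩ := h
  rw [sub_conj_div_sqrtDiscr, mul_comm (k : ℂ)] at hk
  have h1 : ((2 * z.im / rootDisc K : ℝ) : ℂ) = k := mul_left_cancel₀ Complex.two_pi_I_ne_zero hk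
  have h2 : 2 * z.im / rootDisc K = k := by exact_mod_cast h1
  have h3 : |(k : ℝ)| < 1 := by
    rw [← h2, abs_div, abs_of_pos hs, div_lt_one hs, abs_mul, abs_two]
    linarith [Complex.abs_im_le_norm z]
  have h4 : k = 0 := by
    have : |k| < 1 := by exact_mod_cast h3
    exact Int.abs_lt_one_iff.1 this
  rw [h4, Int.cast_zero, div_eq_zero_iff] at h2
  rcases h2 with h2 | h2
  · linarith
  · exact absurd h2 hs.ne'

variable (K) in
theorem finite_quotient_natCast {W : ℕ} (hW : 0 < W) :
    Finite (𝓞 K ⧸ Ideal.span {(W : 𝓞 K)}) :=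
  Ideal.finiteQuotientOfFreeOfNeBot _ (by simpa using hW.ne')

theorem half_le_re_addChar {z : ℂ} (hz : 16 * ‖z‖ ≤ rootDisc K) : 1 / 2 ≤ (addChar K z).re := by
  have hs := rootDisc_pos (K := K)
  rw [addChar_eq, Complex.exp_ofReal_mul_I_re]
  set θ := 4 * Real.pi * z.im / rootDisc K with hθ
  have h1 : |θ| ≤ 1 := by
    rw [hθ, abs_div, abs_of_pos hs, div_le_one hs, abs_mul, abs_of_pos (by positivity)]
    have h3 := Complex.abs_im_le_norm z
    have h4 := Real.pi_lt_four
    calc _ ≤ 4 * 4 * ‖z‖ := by gcongr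
      _ ≤ _ := by linarith
  have h2 : θ ^ 2 ≤ 1 := (sq_le_one_iff_abs_le_one θ).2 h1
  linarith [Real.one_sub_sq_div_two_le_cos (x := θ)]

variable [Algebra.IsQuadraticExtension ℚ K] [IsTotallyComplex K]

theorem modChar_congr {W : ℕ} (hW : 0 < W) (n : 𝓞 K) {x y : 𝓞 K} (h : (W : 𝓞 K) ∣ x - y) :
    modChar σ W n x = modChar σ W n y := by
  obtain ⟨d, hd⟩ := h
  have hW0 : (W : ℂ) ≠ 0 := by exact_mod_cast hW.ne'
  rw [modChar, modChar, ← addChar_add_of_integer σ _ (n * -d)]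
  congr 1
  have h1 : σ x - σ y = W * σ d := by
    have := congrArg (fun z : 𝓞 K => σ z) hd
    simpa using this
  simp only [map_mul, map_neg]
  field_simp
  linear_combination σ n * h1

/-- It suffices to test x = 1 and x = ω: both have absolute value at most s, so triviality there
makes n and nω real, which forces n = 0. -/
theorem exists_modChar_ne_one {W : ℕ} {n : 𝓞 K} (hn : n ≠ 0) (hW : 2 * ‖σ n‖ < W) :
    ∃ x, modChar σ W n x ≠ 1 := by
  by_contra! hall
  obtain ⟨ω, hω, hωre, -⟩ := exists_omega σ
  have hs := one_le_rootDisc (K := K)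
  have hs0 := rootDisc_pos (K := K)
  have hωnorm : ‖σ ω‖ ≤ rootDisc K := by
    refine (Complex.norm_le_abs_re_add_abs_im _).trans ?_
    rw [hω, abs_of_pos (by positivity : 0 < rootDisc K / 2)]
    linarith
  have hW0 : (0 : ℝ) < W := lt_of_le_of_lt (by positivity) hW
  have key : ∀ x : 𝓞 K, ‖σ x‖ ≤ rootDisc K → (σ n * σ x).im = 0 := by
    intro x hx
    have h1 : 2 * ‖σ n * (σ x / W)‖ < rootDisc K := by
      rw [norm_mul, norm_div, Complex.norm_natCast, ← mul_div_assoc, ← mul_div_assoc,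
        div_lt_iff₀ hW0, ← mul_assoc]
      calc _ ≤ 2 * ‖σ n‖ * rootDisc K := by gcongr
        _ < W * rootDisc K := by gcongr
        _ = _ := mul_comm _ _
    have h2 := im_eq_zero_of_addChar_eq_one h1 (hall x)
    rw [← mul_div_assoc, Complex.div_natCast_im] at h2
    simpa [hW0.ne'] using h2
  have h1 := key 1 (by simpa using hs)
  have h2 := key ω hωnorm
  have h3 : (σ n).im = 0 := by simpa using h1
  rw [Complex.mul_im, h3, zero_mul, add_zero, hω] at h2
  have h4 : (σ n).re = 0 := by simpa [hs0.ne'] using h2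
  exact map_coe_ne_zero σ hn (Complex.ext h4 h3)

theorem card_quotient_natCast (σ : K →+* ℂ) (W : ℕ) :
    (Nat.card (𝓞 K ⧸ Ideal.span {(W : 𝓞 K)}) : ℝ) = W ^ 2 := by
  have h := norm_eq_sq σ (W : 𝓞 K)
  have h1 : Nat.card (𝓞 K ⧸ Ideal.span {(W : 𝓞 K)}) = Ideal.absNorm (Ideal.span {(W : 𝓞 K)}) := rfl
  rw [h1, Ideal.absNorm_span_singleton, Nat.cast_natAbs, Int.cast_abs, h,
    abs_of_nonneg (by positivity)]
  simp

theorem sum_modChar_out {W : ℕ} (hW : 0 < W) [Fintype (𝓞 K ⧸ Ideal.span {(W : 𝓞 K)})] {n : 𝓞 K}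
    (hn : n ≠ 0) (hnW : 2 * ‖σ n‖ < W) :
    ∑ g : 𝓞 K ⧸ Ideal.span {(W : 𝓞 K)}, modChar σ W n (Quotient.out g) = 0 := by
  obtain ⟨x, hx⟩ := exists_modChar_ne_one σ hn hnW
  have hmk : ∀ g : 𝓞 K ⧸ Ideal.span {(W : 𝓞 K)},
      Ideal.Quotient.mk (Ideal.span {(W : 𝓞 K)}) (Quotient.out g) = g := fun g => Quotient.out_eq g
  have h1 : ∀ g : 𝓞 K ⧸ Ideal.span {(W : 𝓞 K)}, modChar σ W n
      (Quotient.out (g + Ideal.Quotient.mk (Ideal.span {(W : 𝓞 K)}) x)) =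
      modChar σ W n (Quotient.out g) * modChar σ W n x := by
    intro g
    rw [← modChar_add]
    apply modChar_congr σ hW
    rw [← Ideal.mem_span_singleton, ← Ideal.Quotient.eq, map_add, hmk, hmk]
  have h2 := Equiv.sum_comp (Equiv.addRight (Ideal.Quotient.mk (Ideal.span {(W : 𝓞 K)}) x))
    (fun g => modChar σ W n (Quotient.out g))
  simp only [Equiv.coe_addRight, h1] at h2
  rw [← Finset.sum_mul] at h2
  by_contra h0
  exact hx (mul_left_cancel₀ h0 (h2.trans (mul_one _).symm))

/-- Parseval's identity in the residue ring modulo `W`. -/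
theorem sum_norm_sq_modChar {W : ℕ} (hW : 0 < W) [Fintype (𝓞 K ⧸ Ideal.span {(W : 𝓞 K)})]
    (A : Finset (𝓞 K)) (hA : ∀ n ∈ A, 4 * ‖σ n‖ < W) (c : 𝓞 K → ℂ) :
    ∑ g : 𝓞 K ⧸ Ideal.span {(W : 𝓞 K)}, ‖∑ n ∈ A, c n * modChar σ W n (Quotient.out g)‖ ^ 2 =
      W ^ 2 * ∑ n ∈ A, ‖c n‖ ^ 2 := by
  classical
  have horth : ∀ n ∈ A, ∀ n' ∈ A, ∑ g : 𝓞 K ⧸ Ideal.span {(W : 𝓞 K)},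
      modChar σ W n (Quotient.out g) * (starRingEnd ℂ) (modChar σ W n' (Quotient.out g)) =
      if n = n' then (W : ℂ) ^ 2 else 0 := by
    intro n hn n' hn'
    simp only [modChar_mul_conj]
    split_ifs with h
    · have hcard : (Fintype.card (𝓞 K ⧸ Ideal.span {(W : 𝓞 K)}) : ℂ) = W ^ 2 := by
        have := card_quotient_natCast σ W
        rw [Nat.card_eq_fintype_card] at this
        exact_mod_cast this
      simp [h, modChar, addChar_zero, hcard]
    · refine sum_modChar_out σ hW (sub_ne_zero.2 h) ?_
      have h1 : ‖σ ((n - n' : 𝓞 K) : K)‖ ≤ ‖σ n‖ + ‖σ n'‖ := by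
        simp only [map_sub]
        exact norm_sub_le _ _
      linarith [hA n hn, hA n' hn']
  have h : ((∑ g : 𝓞 K ⧸ Ideal.span {(W : 𝓞 K)},
      ‖∑ n ∈ A, c n * modChar σ W n (Quotient.out g)‖ ^ 2 : ℝ) : ℂ) =
      ((W ^ 2 * ∑ n ∈ A, ‖c n‖ ^ 2 : ℝ) : ℂ) := by
    push_cast
    simp only [← Complex.mul_conj', map_sum, map_mul, Finset.sum_mul_sum]
    rw [Finset.sum_comm, Finset.mul_sum]
    refine Finset.sum_congr rfl fun n hn => ?_
    rw [Finset.sum_comm]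
    have h1 : ∀ n' ∈ A, ∑ g : 𝓞 K ⧸ Ideal.span {(W : 𝓞 K)},
        c n * modChar σ W n (Quotient.out g) *
          ((starRingEnd ℂ) (c n') * (starRingEnd ℂ) (modChar σ W n' (Quotient.out g))) =
        c n * (starRingEnd ℂ) (c n') * if n = n' then (W : ℂ) ^ 2 else 0 := by
      intro n' hn'
      rw [← horth n hn n' hn', Finset.mul_sum]
      refine Finset.sum_congr rfl fun g _ => ?_
      ring
    rw [Finset.sum_congr rfl h1]
    simp only [mul_ite, mul_zero, Finset.sum_ite_eq, hn, if_true]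
    ring
  exact_mod_cast h

/-- Every disc about the origin of radius `ρ` contains at least `ρ² / (4 √|D|)` integers. -/
theorem exists_many_small {ρ : ℝ} (hρ : 0 ≤ ρ) : ∃ B : Finset (𝓞 K), B.Nonempty ∧
    (∀ x ∈ B, ‖σ x‖ ≤ ρ) ∧ ρ ^ 2 / (4 * rootDisc K) ≤ B.card := by
  classical
  obtain ⟨ω, hω, hωre, -⟩ := exists_omega σ
  have hs := one_le_rootDisc (K := K)
  have hs0 := rootDisc_pos (K := K)
  have hωnorm : ‖σ ω‖ ≤ rootDisc K := by
    refine (Complex.norm_le_abs_re_add_abs_im _).trans ?_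
    rw [hω, abs_of_pos (by positivity : 0 < rootDisc K / 2)]
    linarith
  set I := ⌊ρ / 2⌋₊
  set J := ⌊ρ / (2 * rootDisc K)⌋₊
  have hIle : (I : ℝ) ≤ ρ / 2 := Nat.floor_le (by positivity)
  have hJle : (J : ℝ) ≤ ρ / (2 * rootDisc K) := Nat.floor_le (by positivity)
  have hIlt : ρ / 2 < I + 1 := Nat.lt_floor_add_one _
  have hJlt : ρ / (2 * rootDisc K) < J + 1 := Nat.lt_floor_add_one _
  have hmap : ∀ p : ℕ × ℕ, σ (((p.1 : 𝓞 K) + p.2 * ω : 𝓞 K) : K) = p.1 + p.2 * σ ω := by simp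
  refine ⟨(Finset.range (I + 1) ×ˢ Finset.range (J + 1)).image
    fun p : ℕ × ℕ => (p.1 : 𝓞 K) + p.2 * ω, ?_, ?_, ?_⟩
  · rw [Finset.image_nonempty]
    exact ⟨(0, 0), by simp⟩
  · intro x hx
    obtain ⟨p, hp, rfl⟩ := Finset.mem_image.1 hx
    rw [Finset.mem_product, Finset.mem_range, Finset.mem_range] at hp
    rw [hmap]
    have h1 : (p.1 : ℝ) ≤ I := by exact_mod_cast Nat.lt_succ_iff.1 hp.1
    have h2 : (p.2 : ℝ) ≤ J := by exact_mod_cast Nat.lt_succ_iff.1 hp.2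
    calc _ ≤ (p.1 : ℝ) + p.2 * ‖σ ω‖ := by
          refine (norm_add_le _ _).trans ?_
          rw [norm_mul, Complex.norm_natCast, Complex.norm_natCast]
      _ ≤ ρ / 2 + ρ / (2 * rootDisc K) * rootDisc K := by
          gcongr
          · exact h1.trans hIle
          · exact h2.trans hJle
      _ = ρ := by field_simp; ring
  · rw [Finset.card_image_of_injOn, Finset.card_product, Finset.card_range, Finset.card_range]
    · push_cast
      calc _ = ρ / 2 * (ρ / (2 * rootDisc K)) := by field_simp; ring
        _ ≤ _ := by gcongr
    · intro p _ p' _ h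
      have h1 : (p.1 : ℂ) + p.2 * σ ω = p'.1 + p'.2 * σ ω := by
        rw [← hmap, ← hmap]
        exact congrArg (fun z : 𝓞 K => σ z) h
      have h2 : (p.2 : ℝ) * (σ ω).im = p'.2 * (σ ω).im := by
        simpa using congrArg Complex.im h1
      have h3 : (p.2 : ℝ) = p'.2 := mul_right_cancel₀ (by rw [hω]; positivity) h2
      have h4 : (p.1 : ℝ) = p'.1 := by
        have := congrArg Complex.re h1
        simp at this
        rw [h3] at this
        linarith
      exact Prod.ext (by exact_mod_cast h4) (by exact_mod_cast h3)

theorem expSum_eq_sum (a : 𝓞 K → ℂ) (N : ℝ) (z : ℂ) :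
    expSum σ a N z = ∑ n ∈ (finite_normLe K N).toFinset, a n * addChar K (σ n * z) :=
  finsum_mem_eq_finite_toFinset_sum _ _

/-- The large sieve inequality in terms of the number of points in small discs. -/
theorem sum_norm_sq_expSum_le {ι : Type*} {N : ℝ} (hN : 1 ≤ N) (a : 𝓞 K → ℂ) (S : Finset ι)
    (α : ι → 𝓞 K) {W : ℕ} (hW : 4 * Real.sqrt N < W) {P : ℝ} (hP : ∀ γ : 𝓞 K,
      ∀ A : Finset (ι × 𝓞 K), (∀ p ∈ A, p.1 ∈ S ∧
        ‖σ p.2‖ ≤ W * (rootDisc K / (16 * Real.sqrt N)) ∧ (W : 𝓞 K) ∣ α p.1 + p.2 - γ) →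
      (A.card : ℝ) ≤ P) :
    ∑ i ∈ S, ‖expSum σ a N (σ (α i) / W)‖ ^ 2 ≤
      4096 * (N / rootDisc K * P) * ∑ n ∈ (finite_normLe K N).toFinset, ‖a n‖ ^ 2 := by
  classical
  have hs := rootDisc_pos (K := K)
  have hN0 : 0 < Real.sqrt N := Real.sqrt_pos.2 (by linarith)
  have hWr : (0 : ℝ) < W := lt_trans (by positivity) hW
  have hW0 : 0 < W := by exact_mod_cast hWr
  have hfin := finite_quotient_natCast K hW0
  let _ := Fintype.ofFinite (𝓞 K ⧸ Ideal.span {(W : 𝓞 K)})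
  set R := rootDisc K / (16 * Real.sqrt N) with hR
  have hR0 : 0 < R := by positivity
  obtain ⟨B, hBne, hB, hBcard⟩ := exists_many_small σ (ρ := W * R) (by positivity)
  have hBpos : (0 : ℝ) < B.card := by exact_mod_cast hBne.card_pos
  set 𝒩 := (finite_normLe K N).toFinset with h𝒩
  have hnle : ∀ n ∈ 𝒩, ‖σ n‖ ≤ Real.sqrt N := by
    intro n hn
    apply Real.le_sqrt_of_sq_le
    rw [← norm_eq_sq]
    simpa [h𝒩, normLe] using hn
  -- Dividing a_n by the average of the characters over small shifts β writes each exponential sum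
  -- as ∑_β T(α + β). The radius WR keeps every phase within one radian, so cosines are at least 1/2
  -- and |V(n)| ≥ |B|/2. This finite averaging plays the part of a smooth majorant on the torus.
  set V : 𝓞 K → ℂ := fun n => ∑ β ∈ B, modChar σ W n β with hV
  have hVle : ∀ n ∈ 𝒩, (B.card : ℝ) / 2 ≤ ‖V n‖ := by
    intro n hn
    refine le_trans ?_ (Complex.re_le_norm _)
    rw [hV, Complex.re_sum, div_eq_mul_one_div, ← nsmul_eq_mul]
    refine Finset.card_nsmul_le_sum _ _ _ fun β hβ => half_le_re_addChar ?_
    rw [norm_mul, norm_div, Complex.norm_natCast]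
    calc _ ≤ 16 * (Real.sqrt N * (W * R / W)) := by
          gcongr
          · exact hnle n hn
          · exact hB β hβ
      _ = rootDisc K := by
          rw [hR]
          field_simp
  have hVne : ∀ n ∈ 𝒩, V n ≠ 0 := fun n hn h => by
    have := hVle n hn
    rw [h, norm_zero] at this
    linarith
  set c : 𝓞 K → ℂ := fun n => a n / V n with hc
  set T : 𝓞 K ⧸ Ideal.span {(W : 𝓞 K)} → ℂ :=
    fun g => ∑ n ∈ 𝒩, c n * modChar σ W n (Quotient.out g) with hT
  have hmk : ∀ g : 𝓞 K ⧸ Ideal.span {(W : 𝓞 K)},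
      Ideal.Quotient.mk (Ideal.span {(W : 𝓞 K)}) (Quotient.out g) = g := fun g => Quotient.out_eq g
  have hexp : ∀ i, expSum σ a N (σ (α i) / W) =
      ∑ β ∈ B, T (Ideal.Quotient.mk (Ideal.span {(W : 𝓞 K)}) (α i + β)) := by
    intro i
    rw [expSum_eq_sum, hT, Finset.sum_comm]
    refine Finset.sum_congr rfl fun n hn => ?_
    have h1 : ∀ β ∈ B, c n * modChar σ W n
        (Quotient.out (Ideal.Quotient.mk (Ideal.span {(W : 𝓞 K)}) (α i + β))) =
        c n * modChar σ W n (α i) * modChar σ W n β := by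
      intro β _
      rw [mul_assoc, ← modChar_add]
      congr 1
      apply modChar_congr σ hW0
      rw [← Ideal.mem_span_singleton, ← Ideal.Quotient.eq, hmk]
    rw [Finset.sum_congr rfl h1, ← Finset.mul_sum]
    have h2 : a n = c n * V n := by
      rw [hc]
      field_simp [hVne n hn]
    rw [h2]
    simp only [hV, modChar]
    ring
  have hcs : ∀ i, ‖expSum σ a N (σ (α i) / W)‖ ^ 2 ≤
      B.card * ∑ β ∈ B, ‖T (Ideal.Quotient.mk (Ideal.span {(W : 𝓞 K)}) (α i + β))‖ ^ 2 := by
    intro i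
    rw [hexp]
    refine le_trans ?_ sq_sum_le_card_mul_sum_sq
    gcongr
    exact norm_sum_le _ _
  -- Each residue class is hit by at most P pairs (i, β), so the double sum is at most P times the
  -- complete sum, to which Parseval applies.
  have hfib : ∑ i ∈ S, ∑ β ∈ B, ‖T (Ideal.Quotient.mk (Ideal.span {(W : 𝓞 K)}) (α i + β))‖ ^ 2 ≤
      P * ∑ g, ‖T g‖ ^ 2 := by
    rw [← Finset.sum_product', ← Finset.sum_fiberwise_of_maps_to
      (g := fun p : ι × 𝓞 K => Ideal.Quotient.mk (Ideal.span {(W : 𝓞 K)}) (α p.1 + p.2))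
      (t := Finset.univ) (fun _ _ => Finset.mem_univ _), Finset.mul_sum]
    refine Finset.sum_le_sum fun g _ => ?_
    rw [Finset.sum_congr rfl (g := fun _ => ‖T g‖ ^ 2) (fun p hp => by
      rw [(Finset.mem_filter.1 hp).2]), Finset.sum_const, nsmul_eq_mul]
    refine mul_le_mul_of_nonneg_right (hP (Quotient.out g) _ fun p hp => ?_) (by positivity)
    rw [Finset.mem_filter, Finset.mem_product] at hp
    refine ⟨hp.1.1, hB _ hp.1.2, ?_⟩
    rw [← Ideal.mem_span_singleton, ← Ideal.Quotient.eq, hmk, hp.2]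
  have hpars := sum_norm_sq_modChar σ hW0 𝒩 (fun n hn => by linarith [hnle n hn]) c
  have hcle : ∑ n ∈ 𝒩, ‖c n‖ ^ 2 ≤ 4 / B.card ^ 2 * ∑ n ∈ 𝒩, ‖a n‖ ^ 2 := by
    rw [Finset.mul_sum]
    refine Finset.sum_le_sum fun n hn => ?_
    rw [hc, norm_div, div_pow]
    have h1 : ‖a n‖ ^ 2 / ‖V n‖ ^ 2 ≤ ‖a n‖ ^ 2 / ((B.card : ℝ) / 2) ^ 2 := by
      gcongr
      exact hVle n hn
    refine h1.trans (le_of_eq ?_)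
    field_simp
    norm_num
  have hP0 : 0 ≤ P := by simpa using hP 0 ∅ (by simp)
  have hZ : 0 ≤ ∑ n ∈ 𝒩, ‖a n‖ ^ 2 := Finset.sum_nonneg fun _ _ => by positivity
  have hBW : (W : ℝ) ^ 2 / B.card ≤ 1024 * (N / rootDisc K) := by
    rw [div_le_iff₀ hBpos]
    have h1 : (W * R) ^ 2 / (4 * rootDisc K) * (1024 * (N / rootDisc K)) = W ^ 2 := by
      have h2 : Real.sqrt N ^ 2 = N := Real.sq_sqrt (by linarith)
      rw [hR]
      field_simp
      rw [h2]
      ring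
    have hN' : 0 < N / rootDisc K := by positivity
    nlinarith
  calc ∑ i ∈ S, ‖expSum σ a N (σ (α i) / W)‖ ^ 2
      ≤ B.card * (P * ∑ g, ‖T g‖ ^ 2) := by
        refine (Finset.sum_le_sum fun i _ => hcs i).trans ?_
        rw [← Finset.mul_sum]
        gcongr
    _ ≤ B.card * (P * (W ^ 2 * (4 / B.card ^ 2 * ∑ n ∈ 𝒩, ‖a n‖ ^ 2))) := by
        rw [hpars]
        gcongr
    _ = 4 * ((W : ℝ) ^ 2 / B.card) * P * ∑ n ∈ 𝒩, ‖a n‖ ^ 2 := by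
        field_simp
    _ ≤ 4 * (1024 * (N / rootDisc K)) * P * ∑ n ∈ 𝒩, ‖a n‖ ^ 2 := by gcongr
    _ = _ := by ring

end LargeSieve

/-! ### Counting the pairs (q, m) -/

section Counting

theorem card_le_card_image_mul {α β : Type*} [DecidableEq β] (f : α → β) (A : Finset α) {c : ℝ}
    (h : ∀ y ∈ A.image f, ((A.filter fun x => f x = y).card : ℝ) ≤ c) :
    (A.card : ℝ) ≤ (A.image f).card * c := by
  have hcard : (A.card : ℝ) = ∑ y ∈ A.image f, ((A.filter fun x => f x = y).card : ℝ) := by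
    exact_mod_cast Finset.card_eq_sum_card_image f A
  rw [hcard, ← nsmul_eq_mul]
  exact Finset.sum_le_card_nsmul _ _ _ h

/-- With μ = max(|u|, |v|), subtraction gives |z||u − v||u + v| ≤ 2Rμ², while one of the factors |u
± v| is at least μ. The other is then at most 2Rμ/|z|, which is good enough when |z| > R; otherwise
|u − v| ≤ 2B already suffices. -/
theorem near_or_near_neg {u v z w : ℂ} {R B : ℝ} (hR : 0 < R) (hu : ‖z * u ^ 2 - w‖ ≤ R * ‖u‖ ^ 2)
    (hv : ‖z * v ^ 2 - w‖ ≤ R * ‖v‖ ^ 2) (huB : ‖u‖ ≤ B) (hvB : ‖v‖ ≤ B) :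
    ‖u - v‖ ≤ 4 * B * R / (‖z‖ + R) ∨ ‖u + v‖ ≤ 4 * B * R / (‖z‖ + R) := by
  have hz := norm_nonneg z
  have hzR : 0 < ‖z‖ + R := by linarith
  have hB : 0 ≤ B := (norm_nonneg u).trans huB
  by_contra! hcon
  obtain ⟨h1, h2⟩ := hcon
  rw [div_lt_iff₀ hzR] at h1 h2
  set μ := max ‖u‖ ‖v‖ with hμ
  have hμu : ‖u‖ ≤ μ := le_max_left _ _
  have hμv : ‖v‖ ≤ μ := le_max_right _ _
  have hμB : μ ≤ B := max_le huB hvB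
  have hμ0 : 0 ≤ μ := (norm_nonneg u).trans hμu
  have hdiff : ‖u - v‖ ≤ 2 * B := (norm_sub_le u v).trans (by linarith)
  have hzlt : R < ‖z‖ := by
    by_contra! h
    have : ‖u - v‖ * (‖z‖ + R) ≤ 2 * B * (R + R) := by gcongr
    linarith
  have hprod : ‖z‖ * (‖u - v‖ * ‖u + v‖) ≤ 2 * R * μ ^ 2 := by
    have e : z * ((u - v) * (u + v)) = (z * u ^ 2 - w) - (z * v ^ 2 - w) := by ring
    rw [← norm_mul, ← norm_mul, e]
    have e1 : ‖u‖ ^ 2 ≤ μ ^ 2 := by gcongr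
    have e2 : ‖v‖ ^ 2 ≤ μ ^ 2 := by gcongr
    calc _ ≤ R * ‖u‖ ^ 2 + R * ‖v‖ ^ 2 := (norm_sub_le _ _).trans (add_le_add hu hv)
      _ ≤ R * μ ^ 2 + R * μ ^ 2 := by gcongr
      _ = _ := by ring
  have hmax : μ ≤ ‖u - v‖ ∨ μ ≤ ‖u + v‖ := by
    by_contra! h
    have hu2 : 2 * ‖u‖ ≤ ‖u - v‖ + ‖u + v‖ := by
      have : (2 : ℂ) * u = (u - v) + (u + v) := by ring
      calc 2 * ‖u‖ = ‖(2 : ℂ) * u‖ := by simp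
        _ ≤ _ := by rw [this]; exact norm_add_le _ _
    have hv2 : 2 * ‖v‖ ≤ ‖u - v‖ + ‖u + v‖ := by
      have : (2 : ℂ) * v = (u + v) - (u - v) := by ring
      calc 2 * ‖v‖ = ‖(2 : ℂ) * v‖ := by simp
        _ ≤ ‖u + v‖ + ‖u - v‖ := by rw [this]; exact norm_sub_le _ _
        _ = _ := add_comm _ _
    have : μ ≤ (‖u - v‖ + ‖u + v‖) / 2 := max_le (by linarith) (by linarith)
    linarith [h.1, h.2]
  have hfinal : ∀ s t : ℝ, 0 ≤ s → μ ≤ t → 4 * B * R < s * (‖z‖ + R) →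
      ‖z‖ * (s * t) ≤ 2 * R * μ ^ 2 → False := by
    intro s t hs ht hst hle
    have hs0 : 0 < s := by
      by_contra! h
      have : s * (‖z‖ + R) ≤ 0 := mul_nonpos_of_nonpos_of_nonneg h hzR.le
      have : 0 ≤ 4 * B * R := by positivity
      linarith
    have h3 : 2 * B * R < ‖z‖ * s := by nlinarith
    have h4 : ‖z‖ * s * μ ≤ ‖z‖ * (s * t) := by
      rw [← mul_assoc]
      gcongr
    rcases hμ0.eq_or_lt with h | h
    · have hB0 : ‖u‖ = 0 ∧ ‖v‖ = 0 :=
        ⟨le_antisymm (hμu.trans h.symm.le) (norm_nonneg _),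
          le_antisymm (hμv.trans h.symm.le) (norm_nonneg _)⟩
      have hu0 : ‖u - v‖ = 0 := le_antisymm ((norm_sub_le u v).trans (by linarith [hB0.1, hB0.2]))
        (norm_nonneg _)
      rw [hu0, zero_mul] at h1
      have : 0 ≤ 4 * B * R := by positivity
      linarith
    · have h5 : 2 * B * R * μ < ‖z‖ * s * μ := by gcongr
      have h6 : 2 * R * μ ^ 2 ≤ 2 * B * R * μ := by
        have : 2 * R * μ * μ ≤ 2 * R * μ * B := by gcongr
        linarith
      linarith
  rcases hmax with h | h
  · exact hfinal ‖u + v‖ ‖u - v‖ (norm_nonneg _) h h2 (by rwa [mul_comm ‖u + v‖])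
  · exact hfinal ‖u - v‖ ‖u + v‖ (norm_nonneg _) h h1 hprod

variable {K : Type*} [Field K] [NumberField K] [Algebra.IsQuadraticExtension ℚ K]
  [IsTotallyComplex K] (σ : K →+* ℂ)

/-- Both sides being reduced, q² and r divide each other, so all q are associates; they are
multiples of one of them in a disc of the same radius, and 24 = 8(1 + 1 + 1). -/
theorem card_fractions_eq_le (σ : K →+* ℂ) (A : Finset (𝓞 K × 𝓞 K)) {r b : 𝓞 K} (hr : r ≠ 0)
    (hbr : IsCoprime b r) (hA : ∀ p ∈ A, p.1 ≠ 0 ∧ IsCoprime p.2 p.1 ∧ p.2 * r = b * p.1 ^ 2) :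
    (A.card : ℝ) ≤ 24 := by
  classical
  have hs := one_le_rootDisc (K := K)
  rcases A.eq_empty_or_nonempty with rfl | ⟨p₀, hp₀⟩
  · simp
  have hsq : ∀ p ∈ A, r ∣ p.1 ^ 2 ∧ p.1 ^ 2 ∣ r := fun p hp =>
    ⟨hbr.symm.dvd_of_dvd_mul_left ⟨p.2, by rw [← (hA p hp).2.2, mul_comm]⟩,
      (hA p hp).2.1.symm.pow_left.dvd_of_dvd_mul_left ⟨b, by rw [(hA p hp).2.2, mul_comm]⟩⟩
  have hdvd : ∀ p ∈ A, ∀ p' ∈ A, p.1 ∣ p'.1 := fun p hp p' hp' =>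
    (IsIntegrallyClosed.pow_dvd_pow_iff two_ne_zero).1 ((hsq p hp).2.trans (hsq p' hp').1)
  have hinj : Set.InjOn Prod.fst (A : Set (𝓞 K × 𝓞 K)) := by
    intro p hp p' hp' h
    refine Prod.ext h (mul_right_cancel₀ hr ?_)
    rw [(hA p hp).2.2, (hA p' hp').2.2, h]
  have hle : ∀ x y : 𝓞 K, x ∣ y → y ≠ 0 → ‖σ x‖ ≤ ‖σ y‖ := by
    rintro x _ ⟨c, rfl⟩ hy
    simp only [map_mul, norm_mul]
    exact le_mul_of_one_le_right (norm_nonneg _) (one_le_norm σ (right_ne_zero_of_mul hy))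
  rw [← Finset.card_image_of_injOn hinj]
  refine (card_congr_ball_le σ (A.image Prod.fst) 0 (norm_nonneg (σ p₀.1)) (hA p₀ hp₀).1 ?_ ?_).trans
    ?_
  · intro x hx
    obtain ⟨p, hp, rfl⟩ := Finset.mem_image.1 hx
    rw [sub_zero]
    exact hle _ _ (hdvd p hp p₀ hp₀) (hA p₀ hp₀).1
  · intro x hx y hy
    obtain ⟨p, hp, rfl⟩ := Finset.mem_image.1 hx
    obtain ⟨p', hp', rfl⟩ := Finset.mem_image.1 hy
    exact dvd_sub (hdvd p₀ hp₀ p hp) (hdvd p₀ hp₀ p' hp')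
  · rw [div_self (norm_ne_zero_iff.2 (map_coe_ne_zero σ (hA p₀ hp₀).1)), one_pow]
    have : 1 / rootDisc K ≤ 1 := div_le_self zero_le_one hs
    linarith

/-- For each m fix a root q₀ and sort the pairs by the ideal (q − q₀, r) and by whether q is near q₀
or near −q₀. Within a class, `exists_modulus` gives r = hg: there are at most 8|h|²G admissible q
for each m, and the number of admissible m is at most 256F/|h|², so h cancels. -/
theorem card_congruence_pairs_le [IsPrincipalIdealRing (𝓞 K)] (A : Finset (𝓞 K × 𝓞 K))
    {r b : 𝓞 K} (hr : r ≠ 0) (hbr : IsCoprime b r) (Δ : Finset (Ideal (𝓞 K)))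
    (hΔ : ∀ I, r ∈ I ↔ I ∈ Δ) {M ρ : ℝ} (hM : 0 ≤ M) (hρ : 0 ≤ ρ)
    (hA : ∀ p ∈ A, p.2 ≠ 0 ∧ ‖σ p.2‖ ≤ M ∧ r ∣ b * p.1 ^ 2 + p.2)
    (hnear : ∀ p ∈ A, ∀ p' ∈ A, p.2 = p'.2 →
      ‖σ p.1 - σ p'.1‖ ≤ ρ ∨ ‖σ p.1 + σ p'.1‖ ≤ ρ) :
    (A.card : ℝ) ≤ 4096 * Δ.card * ((M + M ^ 2 / rootDisc K) *
      (1 + ρ / ‖σ r‖ + (ρ / ‖σ r‖) ^ 2 / rootDisc K)) := by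
  classical
  have hs := rootDisc_pos (K := K)
  choose! h g hrhg hmod using fun (I : Ideal (𝓞 K)) (hI : I ∈ Δ) =>
    exists_modulus hr ((hΔ I).2 hI)
  have hex : ∀ m : 𝓞 K, ∃ q₀, ∀ q, (q, m) ∈ A → (q₀, m) ∈ A := by
    intro m
    by_cases hm : ∃ q, (q, m) ∈ A
    · exact ⟨hm.choose, fun _ _ => hm.choose_spec⟩
    · exact ⟨0, fun q hq => absurd ⟨q, hq⟩ hm⟩
  choose q₀ hq₀ using hex
  set F := M + M ^ 2 / rootDisc K with hF
  set G := 1 + ρ / ‖σ r‖ + (ρ / ‖σ r‖) ^ 2 / rootDisc K with hG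
  have hF0 : 0 ≤ F := by positivity
  have hG0 : 0 ≤ G := by positivity
  let label : 𝓞 K × 𝓞 K → Ideal (𝓞 K) × Bool := fun p =>
    (Ideal.span {p.1 - q₀ p.2, r}, decide (‖σ p.1 - σ (q₀ p.2)‖ ≤ ρ))
  have hlabel : (A.image label).card ≤ (Δ ×ˢ (Finset.univ : Finset Bool)).card := by
    refine Finset.card_le_card fun y hy => ?_
    obtain ⟨p, hp, rfl⟩ := Finset.mem_image.1 hy
    simp only [label, Finset.mem_product, Finset.mem_univ, and_true]
    exact (hΔ _).1 (Ideal.subset_span (by simp))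
  rw [Finset.card_product, Finset.card_univ, Fintype.card_bool] at hlabel
  have hclass : ∀ y ∈ A.image label,
      ((A.filter fun p => label p = y).card : ℝ) ≤ 2048 * (F * G) := by
    rintro ⟨I, t⟩ hy
    set A' := A.filter fun p => label p = (I, t) with hA'
    have hIΔ : I ∈ Δ := by
      obtain ⟨p, hp, hpI⟩ := Finset.mem_image.1 hy
      have hspan : Ideal.span {p.1 - q₀ p.2, r} = I := congrArg Prod.fst hpI
      rw [← hΔ, ← hspan]
      exact Ideal.subset_span (by simp)
    have hA'sub : ∀ p ∈ A', p ∈ A ∧ Ideal.span {p.1 - q₀ p.2, r} = I ∧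
        decide (‖σ p.1 - σ (q₀ p.2)‖ ≤ ρ) = t := fun p hp => by
      have h1 := Finset.mem_filter.1 hp
      exact ⟨h1.1, congrArg Prod.fst h1.2, congrArg Prod.snd h1.2⟩
    have hrI := hrhg I hIΔ
    have hh0 : h I ≠ 0 := fun h0 => hr (by rw [hrI, h0, zero_mul])
    have hg0 : g I ≠ 0 := fun h0 => hr (by rw [hrI, h0, mul_zero])
    have hkey : ∀ p ∈ A', ∀ p' ∈ A', p.2 = p'.2 →
        g I ∣ p.1 - p'.1 ∧ h I ^ 2 ∣ 4 * p.2 := by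
      intro p hp p' hp' hpp
      obtain ⟨h1, h2, -⟩ := hA'sub p hp
      obtain ⟨h1', h2', -⟩ := hA'sub p' hp'
      have h3 := (hA _ (hq₀ p.2 p.1 h1)).2.2
      have h4 := (hA _ h1).2.2
      have h5 := (hA _ h1').2.2
      rw [← hpp] at h5 h2'
      exact hmod I hIΔ b p.2 (q₀ p.2) p.1 p'.1 hbr h3 h4 h5 h2 h2'
    have hσh := one_le_norm σ hh0
    have hσr : ‖σ r‖ = ‖σ (h I)‖ * ‖σ (g I)‖ := by
      rw [← norm_mul, ← map_mul]
      exact congrArg (fun z : 𝓞 K => ‖σ z‖) hrI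
    have hσg : 0 < ‖σ (g I)‖ := norm_pos_iff.2 (map_coe_ne_zero σ hg0)
    have hfiber : ∀ m ∈ A'.image Prod.snd,
        ((A'.filter fun p => p.2 = m).card : ℝ) ≤ 8 * ‖σ (h I)‖ ^ 2 * G := by
      intro m hm
      have hinj : Set.InjOn Prod.fst ((A'.filter fun p => p.2 = m : Finset (𝓞 K × 𝓞 K)) : Set (𝓞 K × 𝓞 K)) := by
        intro p hp p' hp' hpp
        rw [Finset.mem_coe, Finset.mem_filter] at hp hp'
        exact Prod.ext hpp (hp.2.trans hp'.2.symm)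
      rw [← Finset.card_image_of_injOn hinj]
      refine (card_congr_ball_le σ _ (if t = true then σ (q₀ m) else -σ (q₀ m)) hρ hg0 ?_ ?_).trans ?_
      · intro x hx
        obtain ⟨p, hp, rfl⟩ := Finset.mem_image.1 hx
        rw [Finset.mem_filter] at hp
        obtain ⟨h1, -, h3⟩ := hA'sub p hp.1
        rw [← hp.2, ← h3]
        by_cases hd : ‖σ p.1 - σ (q₀ p.2)‖ ≤ ρ
        · simp [hd]
        · have := (hnear p h1 _ (hq₀ p.2 p.1 h1) rfl).resolve_left hd
          simpa [hd] using this
      · intro x hx y hy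
        obtain ⟨p, hp, rfl⟩ := Finset.mem_image.1 hx
        obtain ⟨p', hp', rfl⟩ := Finset.mem_image.1 hy
        rw [Finset.mem_filter] at hp hp'
        exact (hkey p hp.1 p' hp'.1 (hp.2.trans hp'.2.symm)).1
      · have e : ρ / ‖σ (g I)‖ = ‖σ (h I)‖ * (ρ / ‖σ r‖) := by
          rw [hσr]
          field_simp
        rw [e, hG, mul_pow]
        have h1 : 1 ≤ ‖σ (h I)‖ ^ 2 := one_le_pow₀ hσh
        have h2 : ‖σ (h I)‖ ≤ ‖σ (h I)‖ ^ 2 := le_self_pow₀ hσh two_ne_zero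
        have h3 : 0 ≤ ρ / ‖σ r‖ := by positivity
        calc _ ≤ 8 * (‖σ (h I)‖ ^ 2 * 1 + ‖σ (h I)‖ ^ 2 * (ρ / ‖σ r‖) +
              ‖σ (h I)‖ ^ 2 * (ρ / ‖σ r‖) ^ 2 / rootDisc K) := by
              rw [mul_one]
              gcongr
          _ = _ := by ring
    have hms := card_multiples_le σ (A'.image Prod.snd) hM (pow_ne_zero 2 hh0) (fun m hm => by
      obtain ⟨p, hp, rfl⟩ := Finset.mem_image.1 hm
      obtain ⟨h1, -, -⟩ := hA'sub p hp
      exact ⟨(hA p h1).1, (hA p h1).2.1, (hkey p hp p hp rfl).2⟩)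
    have hpow : ‖σ ((h I ^ 2 : 𝓞 K) : K)‖ = ‖σ (h I)‖ ^ 2 := by
      simp only [map_pow, norm_pow]
    rw [hpow] at hms
    calc (A'.card : ℝ) ≤ (A'.image Prod.snd).card * (8 * ‖σ (h I)‖ ^ 2 * G) :=
          card_le_card_image_mul _ _ hfiber
      _ = 8 * ((A'.image Prod.snd).card * ‖σ (h I)‖ ^ 2) * G := by ring
      _ ≤ 8 * (256 * F) * G := by gcongr
      _ = _ := by ring
  calc (A.card : ℝ) ≤ (A.image label).card * (2048 * (F * G)) := card_le_card_image_mul _ _ hclass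
    _ ≤ ((Δ.card * 2 : ℕ) : ℝ) * (2048 * (F * G)) := by gcongr
    _ = _ := by push_cast; ring

/-- Here w = √Q and T = N^{1/4}. After y = ηs the product expands into six monomials, controlled by
ηT ≤ 4, by s ≥ 1 and, for the term with y in the denominator, by yw² ≥ 1. The mixed terms T³w² and
Tw⁵ are geometric means of neighbouring terms of the target. -/
theorem scaled_count_bound_le {s w T y : ℝ} (hs : 1 ≤ s) (hw : 1 ≤ w) (hT : 1 ≤ T) (hy : 1 ≤ y * w ^ 2)
    (hyT : y ≤ 4 * s / T) :
    T ^ 4 / s * ((y * w ^ 2 + (y * w ^ 2) ^ 2 / s) *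
      (1 + w * s / (4 * T ^ 2 * y) + (w * s / (4 * T ^ 2 * y)) ^ 2 / s)) ≤
      40 * ((w ^ 2) ^ 3 + (w ^ 2) ^ 2 * T ^ 2 + T ^ 4) := by
  have hy0 : 0 < y := by
    by_contra! h
    nlinarith [sq_nonneg w]
  obtain ⟨η, rfl⟩ : ∃ η, y = η * s := ⟨y / s, by field_simp⟩
  have hη : 0 < η := pos_of_mul_pos_left hy0 (by linarith)
  have hηT : η * T ≤ 4 := by
    rw [le_div_iff₀ (by linarith)] at hyT
    by_contra! h
    nlinarith
  have e : T ^ 4 / s * ((η * s * w ^ 2 + (η * s * w ^ 2) ^ 2 / s) *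
      (1 + w * s / (4 * T ^ 2 * (η * s)) + (w * s / (4 * T ^ 2 * (η * s))) ^ 2 / s)) =
      T ^ 3 * w ^ 2 * (η * T) + T ^ 2 * w ^ 4 * (η * T) ^ 2 + T ^ 2 * w ^ 3 / 4 +
        T * w ^ 5 * (η * T) / 4 + w ^ 4 / (16 * (η * s)) + w ^ 6 / (16 * s) := by
    field_simp
    ring
  rw [e]
  have h1 : T ^ 3 * w ^ 2 * (η * T) ≤ T ^ 3 * w ^ 2 * 4 := by gcongr
  have h2 : T ^ 2 * w ^ 4 * (η * T) ^ 2 ≤ T ^ 2 * w ^ 4 * 4 ^ 2 := by gcongr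
  have h3 : T * w ^ 5 * (η * T) / 4 ≤ T * w ^ 5 * 4 / 4 := by gcongr
  have h4 : w ^ 4 / (16 * (η * s)) ≤ w ^ 6 := by
    rw [div_le_iff₀ (by positivity)]
    have : w ^ 4 * 1 ≤ w ^ 4 * (η * s * w ^ 2) := by gcongr
    nlinarith [pow_pos (by linarith : 0 < w) 4]
  have h5 : w ^ 6 / (16 * s) ≤ w ^ 6 := div_le_self (by positivity) (by linarith)
  have h6 : T ^ 2 * w ^ 3 ≤ T ^ 2 * w ^ 4 := 
    mul_le_mul_of_nonneg_left (pow_le_pow_right₀ hw (by norm_num)) (sq_nonneg T)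
  have h7 : 2 * (T ^ 3 * w ^ 2) ≤ T ^ 2 * w ^ 4 + T ^ 4 := by
    nlinarith [sq_nonneg (T * w ^ 2 - T ^ 2)]
  have h8 : 2 * (T * w ^ 5) ≤ T ^ 2 * w ^ 4 + w ^ 6 := by
    nlinarith [sq_nonneg (T * w ^ 2 - w ^ 3)]
  have h9 : 0 ≤ T ^ 4 := by positivity
  have h10 : 0 ≤ T ^ 2 * w ^ 4 := by positivity
  have h11 : 0 ≤ w ^ 6 := by positivity
  rw [← pow_mul, ← pow_mul]
  norm_num
  linarith

end Counting

/-! ### Fractions with square denominators in small discs, and the sieve -/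

section Final

/-- The number of fractions `a / q²` with `N(q) ≤ Q` in a disc of radius `√|D| / (16 √N)`. -/
theorem exists_card_fractions_near_le {ε : ℝ} (hε : 0 < ε) : ∃ C : ℝ, 0 < C ∧
    ∀ (K : Type*) [Field K] [NumberField K] [Algebra.IsQuadraticExtension ℚ K]
      [IsTotallyComplex K], classNumber K = 1 → ∀ (σ : K →+* ℂ) (Q N : ℝ), 1 ≤ Q → 1 ≤ N →
      ∀ (x : ℂ) (A : Finset (𝓞 K × 𝓞 K)), (∀ p ∈ A, p.1 ≠ 0 ∧ ‖σ p.1‖ ^ 2 ≤ Q ∧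
        IsCoprime p.2 p.1 ∧ ‖σ p.2 / σ p.1 ^ 2 - x‖ ≤ rootDisc K / (16 * Real.sqrt N)) →
      N / rootDisc K * A.card ≤ C * N ^ ε * (Q ^ 3 + Q ^ 2 * Real.sqrt N + N) := by
  classical
  obtain ⟨C, hC, hdiv⟩ := exists_card_divisors_le hε
  refine ⟨24 + 163840 * (C * 4 ^ ε), by positivity, ?_⟩
  intro K _ _ _ _ hK σ Q N hQ hN x A hA
  have hpid := classNumber_eq_one_iff.1 hK
  have hs := one_le_rootDisc (K := K)
  have hs0 := rootDisc_pos (K := K)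
  set s := rootDisc K with hsdef
  set T := Real.sqrt (Real.sqrt N) with hTdef
  have hT : 1 ≤ T := Real.one_le_sqrt.2 (Real.one_le_sqrt.2 hN)
  have hT2 : T ^ 2 = Real.sqrt N := Real.sq_sqrt (Real.sqrt_nonneg _)
  have hT4 : T ^ 4 = N := by
    rw [show T ^ 4 = (T ^ 2) ^ 2 by ring, hT2, Real.sq_sqrt (by linarith)]
  set w := Real.sqrt Q with hwdef
  have hw : 1 ≤ w := Real.one_le_sqrt.2 hQ
  have hw2 : w ^ 2 = Q := Real.sq_sqrt (by linarith)
  set R := s / (16 * Real.sqrt N) with hRdef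
  have hR : R = s / (16 * T ^ 2) := by rw [hT2]
  have hR0 : 0 < R := by rw [hR]; positivity
  -- T = N^{1/4} balances the two parts of y: both the approximation error |z||r| and R|r| are then
  -- O(s/T).
  obtain ⟨r₁, b₁, hr₁, hr₁le, happ₁⟩ := exists_approx σ x hT
  obtain ⟨e, r, b, hre, hbe, hcop⟩ := exists_coprime_quotients r₁ b₁ hr₁
  have he : e ≠ 0 := left_ne_zero_of_mul (hre ▸ hr₁)
  have hr : r ≠ 0 := right_ne_zero_of_mul (hre ▸ hr₁)
  have hbr : IsCoprime b r := hcop.symm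
  have he1 := one_le_norm σ he
  have hσr₁ : σ r₁ = σ e * σ r := by rw [hre]; simp only [map_mul]
  have hσb₁ : σ b₁ = σ e * σ b := by rw [hbe]; simp only [map_mul]
  have hσr0 := map_coe_ne_zero σ hr
  have hσrpos : 0 < ‖σ r‖ := norm_pos_iff.2 hσr0
  have hrle : ‖σ r‖ ≤ 2 * T := by
    rw [hσr₁, norm_mul] at hr₁le
    exact (le_mul_of_one_le_left (norm_nonneg _) he1).trans hr₁le
  have happ : ‖σ r * x - σ b‖ ≤ 3 * s / T := by
    rw [hσr₁, hσb₁, mul_assoc, ← mul_sub, norm_mul] at happ₁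
    exact (le_mul_of_one_le_left (norm_nonneg _) he1).trans happ₁
  set z := x - σ b / σ r with hz
  have hzr : ‖z‖ * ‖σ r‖ = ‖σ r * x - σ b‖ := by
    rw [← norm_mul, hz]
    congr 1
    field_simp
  set y := (‖z‖ + R) * ‖σ r‖ with hy
  have hy0 : 0 < y := by positivity
  have hyT : y ≤ 4 * s / T := by
    have h1 : R * ‖σ r‖ ≤ s / (16 * T ^ 2) * (2 * T) := by rw [← hR]; gcongr
    have h2 : s / (16 * T ^ 2) * (2 * T) = 1 / 8 * (s / T) := by field_simp; norm_num
    have h3 : 0 ≤ s / T := by positivity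
    have h4 : 3 * s / T = 3 * (s / T) := by ring
    have h5 : 4 * s / T = 4 * (s / T) := by ring
    rw [hy, add_mul, hzr]
    linarith
  set m : 𝓞 K × 𝓞 K → 𝓞 K := fun p => p.2 * r - b * p.1 ^ 2 with hm
  have hσm : ∀ p, σ (m p) = σ p.2 * σ r - σ b * σ p.1 ^ 2 := fun p => by
    simp only [hm, map_sub, map_mul, map_pow]
  have hmz : ∀ p ∈ A, ‖z * σ p.1 ^ 2 - σ (m p) / σ r‖ ≤ R * ‖σ p.1‖ ^ 2 := by
    intro p hp
    have hq := map_coe_ne_zero σ (hA p hp).1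
    have h1 : z * σ p.1 ^ 2 - σ (m p) / σ r = -((σ p.2 / σ p.1 ^ 2 - x) * σ p.1 ^ 2) := by
      rw [hσm, hz]
      field_simp
      ring
    rw [h1, norm_neg, norm_mul, norm_pow]
    gcongr
    exact (hA p hp).2.2.2
  have hqw : ∀ p ∈ A, ‖σ p.1‖ ≤ w := fun p hp => Real.le_sqrt_of_sq_le (hA p hp).2.1
  have hmle : ∀ p ∈ A, ‖σ (m p)‖ ≤ y * w ^ 2 := by
    intro p hp
    have h1 : ‖σ (m p) / σ r‖ ≤ (‖z‖ + R) * w ^ 2 := by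
      have h2 : σ (m p) / σ r = z * σ p.1 ^ 2 - (z * σ p.1 ^ 2 - σ (m p) / σ r) := by ring
      have h3 : ‖σ p.1‖ ^ 2 ≤ w ^ 2 := pow_le_pow_left₀ (norm_nonneg _) (hqw p hp) 2
      rw [h2]
      calc _ ≤ ‖z‖ * ‖σ p.1‖ ^ 2 + R * ‖σ p.1‖ ^ 2 := by
            refine (norm_sub_le _ _).trans (add_le_add ?_ (hmz p hp))
            rw [norm_mul, norm_pow]
        _ = (‖z‖ + R) * ‖σ p.1‖ ^ 2 := by ring
        _ ≤ _ := by gcongr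
    rw [norm_div, div_le_iff₀ hσrpos] at h1
    calc _ ≤ _ := h1
      _ = _ := by rw [hy]; ring
  set ρ := 4 * w * R / (‖z‖ + R) with hρ
  have hρr : ρ / ‖σ r‖ = w * s / (4 * T ^ 2 * y) := by
    have : 0 < ‖z‖ + R := by positivity
    rw [hρ, hy]
    nth_rewrite 1 [hR]
    field_simp
    ring
  obtain ⟨Δ, hΔ, hΔcard⟩ := hdiv K hK σ r hr
  set B := Q ^ 3 + Q ^ 2 * Real.sqrt N + N with hB
  have hBN : N ≤ B := by
    have : 0 ≤ Q ^ 3 + Q ^ 2 * Real.sqrt N := by positivity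
    linarith
  have hNε : 1 ≤ N ^ ε := Real.one_le_rpow hN hε.le
  have hτ : (Δ.card : ℝ) ≤ C * 4 ^ ε * N ^ ε := by
    rw [mul_assoc, ← Real.mul_rpow (by norm_num) (by linarith)]
    refine hΔcard.trans ?_
    gcongr
    calc ‖σ r‖ ^ 2 ≤ (2 * T) ^ 2 := by gcongr
      _ = 4 * Real.sqrt N := by rw [mul_pow, hT2]; norm_num
      _ ≤ 4 * N := by
        gcongr
        exact Real.sqrt_le_iff.2 ⟨by linarith, by nlinarith⟩
  have hzero : ((A.filter fun p => m p = 0).card : ℝ) ≤ 24 :=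
    card_fractions_eq_le σ _ hr hbr fun p hp => by
      rw [Finset.mem_filter] at hp
      exact ⟨(hA p hp.1).1, (hA p hp.1).2.2.1, sub_eq_zero.1 hp.2⟩
  have hne : N / s * ((A.filter fun p => ¬ m p = 0).card : ℝ) ≤
      163840 * (C * 4 ^ ε * N ^ ε) * B := by
    rcases (A.filter fun p => ¬ m p = 0).eq_empty_or_nonempty with h | ⟨p₁, hp₁⟩
    · rw [h, Finset.card_empty, Nat.cast_zero, mul_zero]
      positivity
    rw [Finset.mem_filter] at hp₁
    -- A nonzero m has absolute value at least 1, so the lower bound on yQ holds as soon as there is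
    -- anything to count.
    have hyQ : 1 ≤ y * w ^ 2 := (one_le_norm σ hp₁.2).trans (hmle p₁ hp₁.1)
    have hinj : Set.InjOn (fun p => (p.1, m p))
        ((A.filter fun p => ¬ m p = 0 : Finset (𝓞 K × 𝓞 K)) : Set (𝓞 K × 𝓞 K)) := by
      intro p _ p' _ h
      rw [Prod.mk.injEq] at h
      refine Prod.ext h.1 (mul_right_cancel₀ hr ?_)
      have h2 := h.2
      simp only [hm] at h2
      rw [h.1] at h2
      exact sub_left_injective h2
    have hcount := card_congruence_pairs_le σ
      ((A.filter fun p => ¬ m p = 0).image fun p => (p.1, m p)) hr hbr Δ hΔ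
      (M := y * w ^ 2) (ρ := ρ) (by positivity) (by positivity)
      (fun p hp => by
        obtain ⟨p, hpA, rfl⟩ := Finset.mem_image.1 hp
        rw [Finset.mem_filter] at hpA
        exact ⟨hpA.2, hmle p hpA.1, ⟨p.2, by simp only [hm]; ring⟩⟩)
      (fun p hp p' hp' hpp => by
        obtain ⟨p, hpA, rfl⟩ := Finset.mem_image.1 hp
        obtain ⟨p', hpA', rfl⟩ := Finset.mem_image.1 hp'
        rw [Finset.mem_filter] at hpA hpA'
        have h1 := hmz p' hpA'.1
        have hpp' : m p = m p' := hpp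
        rw [← hpp'] at h1
        exact near_or_near_neg hR0 (hmz p hpA.1) h1 (hqw p hpA.1) (hqw p' hpA'.1))
    rw [Finset.card_image_of_injOn hinj, hρr, ← hsdef] at hcount
    have haux := scaled_count_bound_le hs hw hT hyQ hyT
    rw [hT4, hw2, hT2, ← hB] at haux
    rw [hT2, hw2] at hcount
    set E := (y * Q + (y * Q) ^ 2 / s) *
      (1 + w * s / (4 * Real.sqrt N * y) + (w * s / (4 * Real.sqrt N * y)) ^ 2 / s)
    calc _ ≤ N / s * (4096 * Δ.card * E) := by gcongr
      _ = 4096 * Δ.card * (N / s * E) := by ring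
      _ ≤ 4096 * (C * 4 ^ ε * N ^ ε) * (40 * B) := by gcongr
      _ = _ := by ring
  have hsplit : (A.card : ℝ) = (A.filter fun p => m p = 0).card +
      (A.filter fun p => ¬ m p = 0).card := by
    exact_mod_cast (Finset.card_filter_add_card_filter_not _).symm
  have hNs : N / s ≤ N := div_le_self (by linarith) hs
  rw [hsplit, mul_add]
  calc _ ≤ N * 24 + 163840 * (C * 4 ^ ε * N ^ ε) * B := by gcongr
    _ ≤ (1 * B) * 24 + 163840 * (C * 4 ^ ε * N ^ ε) * B := by
      rw [one_mul]
      gcongr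
    _ ≤ (N ^ ε * B) * 24 + 163840 * (C * 4 ^ ε * N ^ ε) * B := by gcongr
    _ = _ := by ring

theorem isCoprime_of_mk_mem_reducedClasses {K : Type*} [Field K] [NumberField K] {q x : 𝓞 K}
    (h : Ideal.Quotient.mk (Ideal.span {q ^ 2}) x ∈ reducedClasses q) : IsCoprime x q := by
  obtain ⟨b, hb, hbq⟩ := h
  obtain ⟨d, hd⟩ := Ideal.mem_span_singleton.1 (Ideal.Quotient.eq.1 hb.symm)
  have hx : x = b + q * (q * d) := by linear_combination hd
  rw [hx]
  exact hbq.add_mul_left_left _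

variable {K : Type*} [Field K] [NumberField K] [Algebra.IsQuadraticExtension ℚ K]
  [IsTotallyComplex K] (σ : K →+* ℂ)

/-- The square moduli large sieve, in terms of the number of fractions in small discs. -/
theorem sieveSum_le {Q N : ℝ} (hN : 1 ≤ N) (a : 𝓞 K → ℂ) {P : ℝ}
    (hP : ∀ (x : ℂ) (A : Finset (𝓞 K × 𝓞 K)), (∀ p ∈ A, p.1 ≠ 0 ∧ ‖σ p.1‖ ^ 2 ≤ Q ∧
      IsCoprime p.2 p.1 ∧ ‖σ p.2 / σ p.1 ^ 2 - x‖ ≤ rootDisc K / (16 * Real.sqrt N)) →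
      (A.card : ℝ) ≤ P) :
    sieveSum σ a Q N ≤ 4096 * (N / rootDisc K * P) * ∑ᶠ n ∈ normLe K N, ‖a n‖ ^ 2 := by
  classical
  have hfinQ : (normLe K Q \ {0}).Finite := (finite_normLe K Q).sdiff
  set 𝒬 := hfinQ.toFinset with h𝒬
  have hq0 : ∀ q ∈ 𝒬, q ≠ 0 := fun q hq => by
    have := (hfinQ.mem_toFinset.1 hq).2
    simpa using this
  have hqQ : ∀ q ∈ 𝒬, ‖σ q‖ ^ 2 ≤ Q := fun q hq => by
    rw [← norm_eq_sq]
    exact (hfinQ.mem_toFinset.1 hq).1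
  let classes : ∀ q : 𝓞 K, Finset (𝓞 K ⧸ Ideal.span {q ^ 2}) := fun q =>
    if hq : q ≠ 0 then (finite_reducedClasses hq).toFinset else ∅
  have hclasses : ∀ q ∈ 𝒬, ∀ c, c ∈ classes q ↔ c ∈ reducedClasses q := fun q hq c => by
    simp only [classes, dif_pos (hq0 q hq), Set.Finite.mem_toFinset]
  -- A common multiple of all the q² puts every fraction over the single denominator W; the extra
  -- factor makes W exceed 4√N, so that the characters n remain orthogonal.
  set W : ℕ := (∏ q ∈ 𝒬, Ideal.absNorm (Ideal.span {q ^ 2})) * (⌊4 * Real.sqrt N⌋₊ + 1) with hW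
  have hprod : 0 < ∏ q ∈ 𝒬, Ideal.absNorm (Ideal.span {q ^ 2}) := by
    refine Finset.prod_pos fun q hq => Nat.pos_of_ne_zero fun h => ?_
    rw [Ideal.absNorm_eq_zero_iff] at h
    simp [hq0 q hq] at h
  have hWlt : 4 * Real.sqrt N < W := by
    refine (Nat.lt_floor_add_one _).trans_le ?_
    exact_mod_cast Nat.le_mul_of_pos_left _ hprod
  have hWpos : (0 : ℝ) < W := lt_of_le_of_lt (by positivity) hWlt
  have hW0 : (W : ℂ) ≠ 0 := by exact_mod_cast hWpos.ne'
  have hdvd : ∀ q ∈ 𝒬, q ^ 2 ∣ (W : 𝓞 K) := by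
    intro q hq
    have h1 : q ^ 2 ∣ ((Ideal.absNorm (Ideal.span {q ^ 2}) : ℕ) : 𝓞 K) :=
      Ideal.mem_span_singleton.1 (Ideal.absNorm_mem _)
    refine h1.trans (Nat.cast_dvd_cast ?_)
    exact (Finset.dvd_prod_of_mem (fun q : 𝓞 K => Ideal.absNorm (Ideal.span {q ^ 2})) hq).mul_right _
  choose! k hk using hdvd
  have hσk : ∀ q ∈ 𝒬, (W : ℂ) = σ q ^ 2 * σ (k q) := by
    intro q hq
    have := congrArg (fun x : 𝓞 K => σ x) (hk q hq)
    simpa using this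
  let α : (Σ q : 𝓞 K, 𝓞 K ⧸ Ideal.span {q ^ 2}) → 𝓞 K := fun i => Quotient.out i.2 * k i.1
  have hmk : ∀ (q : 𝓞 K) (c : 𝓞 K ⧸ Ideal.span {q ^ 2}),
      Ideal.Quotient.mk (Ideal.span {q ^ 2}) (Quotient.out c) = c := fun q c => Quotient.out_eq c
  have hsum : sieveSum σ a Q N = ∑ i ∈ 𝒬.sigma classes, ‖expSum σ a N (σ (α i) / W)‖ ^ 2 := by
    rw [sieveSum, finsum_mem_eq_finite_toFinset_sum _ hfinQ, Finset.sum_sigma]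
    refine Finset.sum_congr rfl fun q hq => ?_
    rw [finsum_mem_eq_finite_toFinset_sum _ (finite_reducedClasses (hq0 q hq))]
    have hcl : (finite_reducedClasses (hq0 q hq)).toFinset = classes q := by
      simp only [classes, dif_pos (hq0 q hq)]
    rw [hcl]
    refine Finset.sum_congr rfl fun c _ => ?_
    have h1 : σ (Quotient.out c : 𝓞 K) / σ q ^ 2 = σ (α ⟨q, c⟩) / W := by
      have hne := hW0
      rw [hσk q hq] at hne ⊢
      have h2 : σ q ^ 2 ≠ 0 := left_ne_zero_of_mul hne
      have h3 : σ (k q) ≠ 0 := right_ne_zero_of_mul hne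
      simp only [α, map_mul]
      rw [mul_div_mul_right _ _ h3]
    rw [h1]
  rw [hsum, finsum_mem_eq_finite_toFinset_sum _ (finite_normLe K N)]
  refine sum_norm_sq_expSum_le σ hN a _ α hWlt fun γ A hA => ?_
  choose! d hd using fun p (hp : p ∈ A) => (hA p hp).2.2
  -- If α + β − γ = Wd, the representative c − q²d of the class gives a fraction that differs from
  -- γ/W by exactly −β/W. The shift by d undoes the reduction modulo W, so congruence becomes
  -- proximity in the plane.
  let F : (Σ q : 𝓞 K, 𝓞 K ⧸ Ideal.span {q ^ 2}) × 𝓞 K → 𝓞 K × 𝓞 K :=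
    fun p => (p.1.1, Quotient.out p.1.2 - p.1.1 ^ 2 * d p)
  have hmkF : ∀ p, Ideal.Quotient.mk (Ideal.span {p.1.1 ^ 2}) (F p).2 = p.1.2 := by
    intro p
    refine Eq.trans ?_ (hmk _ p.1.2)
    rw [Ideal.Quotient.eq, Ideal.mem_span_singleton]
    exact ⟨-d p, by simp only [F]; ring⟩
  have hmem : ∀ p ∈ A, p.1.1 ∈ 𝒬 ∧ p.1.2 ∈ classes p.1.1 := fun p hp =>
    Finset.mem_sigma.1 (hA p hp).1
  have hβ : ∀ p ∈ A, p.2 = γ - k p.1.1 * (F p).2 := by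
    intro p hp
    have h1 := hd p hp
    rw [hk _ (hmem p hp).1] at h1
    simp only [α, F] at h1 ⊢
    linear_combination h1
  have hinj : Set.InjOn F (A : Set ((Σ q : 𝓞 K, 𝓞 K ⧸ Ideal.span {q ^ 2}) × 𝓞 K)) := by
    intro p hp p' hp' h
    have h1 : p.1.1 = p'.1.1 := congrArg Prod.fst h
    have hsnd : p.2 = p'.2 := by rw [hβ p hp, hβ p' hp', h, h1]
    have e1 := hmkF p
    have e2 := hmkF p'
    rw [h] at e1
    obtain ⟨⟨q, c⟩, β⟩ := p
    obtain ⟨⟨q', c'⟩, β'⟩ := p'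
    simp only at h1 hsnd e1 e2
    subst h1 hsnd
    rw [e1.symm.trans e2]
  rw [← Finset.card_image_of_injOn hinj]
  refine hP (σ γ / W) _ fun y hy => ?_
  obtain ⟨p, hp, rfl⟩ := Finset.mem_image.1 hy
  obtain ⟨hp1, hp2⟩ := hmem p hp
  refine ⟨hq0 _ hp1, hqQ _ hp1, ?_, ?_⟩
  · apply isCoprime_of_mk_mem_reducedClasses
    rw [hmkF]
    exact (hclasses _ hp1 _).1 hp2
  · have hne := hW0
    rw [hσk _ hp1] at hne
    have h2 : σ (p.1.1) ^ 2 ≠ 0 := left_ne_zero_of_mul hne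
    have h3 : σ (k p.1.1) ≠ 0 := right_ne_zero_of_mul hne
    have h4 : σ p.2 = σ γ - σ (k p.1.1) * σ (F p).2 := by
      rw [hβ p hp]
      simp only [map_sub, map_mul]
    have h5 : σ (F p).2 / σ (F p).1 ^ 2 - σ γ / W = -(σ p.2 / W) := by
      change σ (F p).2 / σ p.1.1 ^ 2 - σ γ / W = -(σ p.2 / W)
      rw [h4, hσk _ hp1]
      field_simp
      ring
    rw [h5, norm_neg, norm_div, Complex.norm_natCast, div_le_iff₀ hWpos, mul_comm]
    exact (hA p hp).2.1

end Final

end SquareSieve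

theorem theorem1p4 (ε : ℝ) (hε : 0 < ε) :
    ∃ C : ℝ, 0 < C ∧
      ∀ (K : Type*) [Field K] [NumberField K] [Algebra.IsQuadraticExtension ℚ K]
        [NumberField.IsTotallyComplex K], NumberField.classNumber K = 1 →
      ∀ (σ : K →+* ℂ) (Q N : ℝ), 1 ≤ Q → 1 ≤ N → ∀ a : NumberField.RingOfIntegers K → ℂ,
        SquareSieve.sieveSum σ a Q N ≤
          C * (Q * N) ^ ε * (Q ^ 3 + Q ^ 2 * Real.sqrt N + N) *
            ∑ᶠ n ∈ SquareSieve.normLe K N, ‖a n‖ ^ 2 := by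
  obtain ⟨C, hC, hcount⟩ := SquareSieve.exists_card_fractions_near_le hε
  refine ⟨4096 * C, by positivity, ?_⟩
  intro K _ _ _ _ hK σ Q N hQ hN a
  have hs := SquareSieve.rootDisc_pos (K := K)
  have hN0 : 0 < N := by linarith
  set B := Q ^ 3 + Q ^ 2 * Real.sqrt N + N with hB
  have hB0 : 0 ≤ B := by positivity
  have hZ : 0 ≤ ∑ᶠ n ∈ SquareSieve.normLe K N, ‖a n‖ ^ 2 :=
    finsum_nonneg fun _ => finsum_nonneg fun _ => by positivity
  refine (SquareSieve.sieveSum_le σ hN a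
    (P := SquareSieve.rootDisc K / N * (C * N ^ ε * B)) fun x A hA => ?_).trans ?_
  · have h := hcount K hK σ Q N hQ hN x A hA
    rw [div_mul_eq_mul_div, le_div_iff₀ hN0]
    rw [div_mul_eq_mul_div, div_le_iff₀ hs] at h
    linarith
  · have h1 : N / SquareSieve.rootDisc K * (SquareSieve.rootDisc K / N * (C * N ^ ε * B)) =
        C * N ^ ε * B := by field_simp
    rw [h1]
    refine mul_le_mul_of_nonneg_right ?_ hZ
    have h2 : N ^ ε ≤ (Q * N) ^ ε :=
      Real.rpow_le_rpow hN0.le (le_mul_of_one_le_left hN0.le hQ) hε.le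
    calc 4096 * (C * N ^ ε * B) ≤ 4096 * (C * (Q * N) ^ ε * B) := by gcongr
      _ = _ := by ring
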